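/- **Theorem 2.5.** Let $f:\mathbb R^3\to\mathbb C$ be continuous with compact support contained in the open half-space $\{x_3>0\}$. For $\lambda\ge 0$, $-\pi/2\le\theta<\pi/2$, $-\pi\le\phi<\pi$ let $$l_{\lambda,\theta,\phi}=\{(\lambda\cos\phi-t\cos\theta\sin\phi,\ \lambda\sin\phi+t\cos\theta\cos\phi,\ t\sin\theta):t\in\mathbb R\}$$ (these are the lines which have equal distances from $e_3$ and $-e_3$), and let $G(\lambda,\theta,\phi)=\int_{l_{\lambda,\theta,\phi}}f\,dl$, where $dl$ is the length measure. For $n\in\mathbb Z$ let $$f_n(r,\tau)=\frac1{2\pi}\int_{-\pi}^{\pi}f(r\cos\varphi,r\sin\varphi,\tau)e^{-in\varphi}d\varphi,\qquad G_n(\lambda,\theta)=\frac1{2\pi}\int_{-\pi}^{\pi}G(\lambda,\theta,\phi)e^{-in\phi}d\phi$$ be the Fourier coefficients of $f$ and $G$ in the azimuthal angle. Let $(\mathcal M F)(s)=\int_0^\infty y^{s-1}F(y)\,dy$ be the Mellin transform, $\mathcal M_i$ the Mellin transform in the $i$-th variable, $n'=\max(0,n+1)$, and $$\mathcal I_n(\zeta,\xi)=\int_0^\infty(1+t^2)^{-\zeta/2}t^{-\xi}(1+it)^n\,dt,$$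 $$G_n^*(\lambda,s)=\frac{G_n(\lambda,\arctan s)}{\sqrt{1+s^2}},\qquad G_n^{**}(\lambda,\xi)=\lambda^{\xi-n-1}\,\mathcal M_2[G_n^*](\lambda,\xi),\qquad U_n(\zeta,\xi)=\frac{\mathcal M_1[G_n^{**}](\zeta,\xi)}{\mathcal I_n(\zeta,\xi)}.$$ Then, for every $n\in\mathbb Z$: 1. The integral $\mathcal M_2[G_n^*](\lambda,\xi)$ converges absolutely for $\lambda\ge0$, $0<\Re\xi<1$; the integrals $\mathcal M_1[G_n^{**}](\zeta,\xi)$ and $\mathcal I_n(\zeta,\xi)$ converge absolutely for $\Re\zeta>n'$, $0<\Re\xi<1$; and for every $\varrho_1>n'$ and every $\xi$ with $0<\Re\xi<1$ one has $\mathcal I_n(\varrho_1+iy,\xi)\ne0$ for almost every $y\in\mathbb R$, so that $U_n(\cdot,\xi)$ is defined almost everywhere on the line $\Re\zeta=\varrho_1$. 2. For all $r,\tau>0$, $$f_n(r,\tau)=r^n\,\mathcal M_2^{-1}\big[\mathcal M_1^{-1}[U_n(\cdot,\xi)]\big](r,\tau).$$ Here $\mathcal M_1^{-1}$ is taken on any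 line $\Re\zeta=\varrho_1>n'$ for every $\xi$ with $0<\Re\xi<1$ (and its value does not depend on $\varrho_1$), $\mathcal M_2^{-1}$ is taken on any line $\Re\xi=\varrho_2\in(0,1)$, and the inverse Mellin integral $\frac1{2\pi i}\int_{\varrho-i\infty}^{\varrho+i\infty}x^{-s}V(s)\,ds$ is understood as the limit of its Gauss-Weierstrass means, $$(\mathcal M^{-1}V)(x)=\lim_{\varepsilon\to0^+}\frac1{2\pi}\int_{-\infty}^{\infty}e^{-\varepsilon y^2}x^{-(\varrho+iy)}V(\varrho+iy)\,dy;$$ the integrals under the limit converge absolutely and the limits exist. 3. The same formula holds with $(\mathcal M^{-1}V)(x)=\lim_{A\to\infty}\frac1{2\pi i}\int_{\varrho-iA}^{\varrho+iA}x^{-s}V(s)\,ds$ for all $r,\tau>0$, $\varrho_1>n'$, $\varrho_2\in(0,1)$ for which these limits exist (the inner one for almost every $\xi$ on the line $\Re\xi=\varrho_2$). 4. If $r_0,\tau_0\ge0$, then $f_n(r,\tau)\to f_n(r_0,\tau_0)$ as $(r,\tau)\to(r_0,\tau_0)$ with $r,\tau>0$, so that the formula also determines $f_n$ at $r=0$ and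 at $\tau=0$. -/

import Mathlib

open MeasureTheory Set Filter Topology

namespace EquidistantLines

noncomputable section

/-- Euclidean three-space. -/
abbrev E3 : Type := EuclideanSpace ℝ (Fin 3)

/-- The point with parameter `t` on the line `l_{lam, θ, φ}`: the line passes through
`(lam cos φ, lam sin φ, 0)`, where it is closest to the origin, and its direction is the unit vector
`(- cos θ sin φ, cos θ cos φ, sin θ)`. For `lam ≥ 0`, `-π / 2 ≤ θ < π / 2`, `-π ≤ φ < π` these are
the lines which have equal distances from `e₃` and `-e₃`. -/
def linePoint (lam θ φ t : ℝ) : E3 :=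
  !₂[lam * Real.cos φ - t * Real.cos θ * Real.sin φ,
     lam * Real.sin φ + t * Real.cos θ * Real.cos φ,
     t * Real.sin θ]

/-- `t ↦ linePoint lam θ φ t` parametrizes the line by arc length, so that integration with respect
to `t` is integration with respect to the length measure of the line. -/
theorem isometry_linePoint (lam θ φ : ℝ) : Isometry (linePoint lam θ φ) := by
  refine Isometry.of_dist_eq fun a b => ?_
  rw [EuclideanSpace.dist_eq, Real.dist_eq, ← Real.sqrt_sq_eq_abs]
  congr 1
  simp only [linePoint, Real.dist_eq, sq_abs, Fin.sum_univ_three, PiLp.toLp_apply,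
    Matrix.cons_val_zero, Matrix.cons_val_one, Matrix.cons_val]
  linear_combination (a - b) ^ 2 * (Real.cos θ ^ 2 * Real.sin_sq_add_cos_sq φ +
    Real.sin_sq_add_cos_sq θ)

/-- The data: `G(lam, θ, φ)` is the integral of `f` over the line `l_{lam, θ, φ}` with respect to the
length measure. -/
def lineData (f : E3 → ℂ) (lam θ φ : ℝ) : ℂ :=
  ∫ t : ℝ, f (linePoint lam θ φ t)

theorem neg_pi_lt_pi : -Real.pi < Real.pi := by linarith [Real.pi_pos]

/-- The Fourier coefficient `f_n(r, τ)` of `φ ↦ f(r cos φ, r sin φ, τ)`, that is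
`(2π)⁻¹ ∫_{-π}^{π} f(r cos φ, r sin φ, τ) e^{-inφ} dφ`. -/
def fCoeff (f : E3 → ℂ) (n : ℤ) (r τ : ℝ) : ℂ :=
  fourierCoeffOn neg_pi_lt_pi (fun φ : ℝ => f !₂[r * Real.cos φ, r * Real.sin φ, τ]) n

/-- The Fourier coefficient `G_n(lam, θ)` of `φ ↦ G(lam, θ, φ)`, that is
`(2π)⁻¹ ∫_{-π}^{π} G(lam, θ, φ) e^{-inφ} dφ`. -/
def GCoeff (f : E3 → ℂ) (n : ℤ) (lam θ : ℝ) : ℂ :=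
  fourierCoeffOn neg_pi_lt_pi (fun φ : ℝ => lineData f lam θ φ) n

/-- `G_n^*(lam, s) = G_n(lam, arctan s) / √(1 + s²)`. -/
def GStar (f : E3 → ℂ) (n : ℤ) (lam s : ℝ) : ℂ :=
  GCoeff f n lam (Real.arctan s) / (Real.sqrt (1 + s ^ 2) : ℂ)

/-- `G_n^{**}(lam, ξ) = lam^{ξ - n - 1} M₂[G_n^*](lam, ξ)`, where `M₂` is the Mellin transform in the
second variable. -/
def GStarStar (f : E3 → ℂ) (n : ℤ) (lam : ℝ) (ξ : ℂ) : ℂ :=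
  (lam : ℂ) ^ (ξ - n - 1) * mellin (fun s : ℝ => GStar f n lam s) ξ

/-- The integrand of `I_n(ζ, ξ)`. -/
def kernelI (n : ℤ) (ζ ξ : ℂ) (t : ℝ) : ℂ :=
  ((1 + t ^ 2 : ℝ) : ℂ) ^ (-ζ / 2) * (t : ℂ) ^ (-ξ) * (1 + Complex.I * (t : ℂ)) ^ n

/-- `I_n(ζ, ξ) = ∫₀^∞ (1 + t²)^{-ζ/2} t^{-ξ} (1 + it)^n dt`. -/
def integralI (n : ℤ) (ζ ξ : ℂ) : ℂ :=
  ∫ t in Ioi (0 : ℝ), kernelI n ζ ξ t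

/-- `U_n(ζ, ξ) = M₁[G_n^{**}](ζ, ξ) / I_n(ζ, ξ)`, where `M₁` is the Mellin transform in the first
variable. -/
def U (f : E3 → ℂ) (n : ℤ) (ζ ξ : ℂ) : ℂ :=
  mellin (fun lam : ℝ => GStarStar f n lam ξ) ζ / integralI n ζ ξ

/-- `n' = max(0, n + 1)`. -/
def nPrime (n : ℤ) : ℝ := ((max 0 (n + 1) : ℤ) : ℝ)

/-- The integrand of the Mellin inversion integral
`(2πi)⁻¹ ∫_{ρ - i∞}^{ρ + i∞} x^{-s} V(s) ds = (2π)⁻¹ ∫_{-∞}^{∞} x^{-(ρ + iy)} V(ρ + iy) dy`. -/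
def invIntegrand (ρ : ℝ) (V : ℂ → ℂ) (x y : ℝ) : ℂ :=
  (x : ℂ) ^ (-((ρ : ℂ) + y * Complex.I)) * V ((ρ : ℂ) + y * Complex.I)

/-- The Mellin inversion integral of `V` on the line `Re s = ρ` converges at `x` to `v` as an
improper integral `lim_{A → ∞} (2πi)⁻¹ ∫_{ρ - iA}^{ρ + iA} x^{-s} V(s) ds`. -/
def HasMellinInv (ρ : ℝ) (V : ℂ → ℂ) (x : ℝ) (v : ℂ) : Prop :=
  (∀ A : ℝ, IntervalIntegrable (invIntegrand ρ V x) volume (-A) A) ∧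
  Tendsto (fun A : ℝ => (1 / (2 * Real.pi) : ℂ) * ∫ y in (-A)..A, invIntegrand ρ V x y)
    atTop (𝓝 v)

/-- The Mellin inversion integral of `V` on the line `Re s = ρ` is summable at `x` to `v` by the
Gauss-Weierstrass means
`lim_{ε → 0+} (2π)⁻¹ ∫_{-∞}^{∞} e^{-ε y²} x^{-(ρ + iy)} V(ρ + iy) dy`, the usual sense in which the
Fourier integral of the transform of an integrable function recovers that function at its points of
continuity. -/
def HasGaussMellinInv (ρ : ℝ) (V : ℂ → ℂ) (x : ℝ) (v : ℂ) : Prop :=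
  (∀ ε : ℝ, 0 < ε →
    Integrable (fun y : ℝ => (Real.exp (-ε * y ^ 2) : ℂ) * invIntegrand ρ V x y)) ∧
  Tendsto (fun ε : ℝ => (1 / (2 * Real.pi) : ℂ) *
      ∫ y : ℝ, (Real.exp (-ε * y ^ 2) : ℂ) * invIntegrand ρ V x y)
    (𝓝[>] 0) (𝓝 v)

end

end EquidistantLines

/-! On a line with parameters `lam`, `θ`, `φ`, the point with parameter `t` has azimuth `φ + α`,
where `α` is the argument of `lam + iu` and `u = t cos θ`. Its distance from the axis is `√(lam² +
u²)` and its height is `us`, `s = tan θ`. Rotation of the line is thus a shift in azimuth, and the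
line transform acts on each Fourier coefficient separately: for `s > 0`, `GStar` is the integral
over `u > 0` of a phase times `f_n(√(lam² + u²), us)` (`SupportBounds.GStar_eq`).

In `s` this is a superposition of dilates, which a Mellin transform turns into powers `u^{-ξ}`.
After `u = lam t` and multiplication by `lam^{ξ-n-1}`, what remains is a superposition of dilates by
`√(1+t²)` of one function of the radius, `reducedMellin`. A second Mellin transform yields a
product, `I_n(ζ, ξ)` times the Mellin transform of `reducedMellin`
(`SupportBounds.mellin_GStarStar`), so `U` is the double Mellin transform of `r^{-n} f_n` wherever
`I_n` is nonzero.

The kernel `I_n` is holomorphic in `ζ` and, by Laplace's method as `ζ → +∞`, not identically zero,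
so its zeros on a vertical line form a null set (`ae_integralI_ne_zero`). Mellin inversion by Gauss
means holds at every point of continuity (`hasGaussMellinInv_of_ae_eq_mellin`). An inversion
integral that converges has the same value, its Gauss means being averages of its partial integrals.
-/

namespace EquidistantLines

/-! ### Gauss-Weierstrass inversion of Fourier and Mellin transforms. -/

-- Moving the Fourier transform from `g` to the Gaussian leaves `g` integrated against an
-- approximate identity centred at `v`; `𝓕 g` itself need not be integrable.
open scoped FourierTransform in
theorem tendsto_integral_gaussian_mul_fourier {g : ℝ → ℂ} (hg : Integrable g) {v : ℝ}
    (hc : ContinuousAt g v) :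
    Tendsto (fun c : ℝ => ∫ w : ℝ,
      Complex.exp (-(c : ℂ)⁻¹ * (‖w‖ : ℂ) ^ 2 + 2 * Real.pi * Complex.I * (inner ℝ v w : ℝ)) • 𝓕 g w)
      atTop (𝓝 (g v)) := by
  have B : Tendsto (fun (c : ℝ) ↦ (∫ w : ℝ,
        𝓕 (fun w : ℝ ↦ Complex.exp (-(c : ℂ)⁻¹ * (‖w‖ : ℂ) ^ 2 +
          2 * Real.pi * Complex.I * (inner ℝ v w : ℝ))) w • g w)) atTop (𝓝 (g v)) := by
    apply (Real.tendsto_integral_gaussian_smul' hg hc).congr'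
    filter_upwards [Ioi_mem_atTop 0] with c (hc : 0 < c)
    congr with w
    rw [fourier_gaussian_innerProductSpace' (by simpa)]
    congr 2
    · simp
    · congr 1
      rw [div_inv_eq_mul]
      ring
  apply B.congr'
  filter_upwards [Ioi_mem_atTop 0] with c (hc : 0 < c)
  have J : Integrable (fun w : ℝ ↦ Complex.exp (-(c : ℂ)⁻¹ * (‖w‖ : ℂ) ^ 2 +
      2 * Real.pi * Complex.I * (inner ℝ v w : ℝ))) :=
    GaussianFourier.integrable_cexp_neg_mul_sq_norm_add (by simpa) _ _
  simpa using! (VectorFourier.integral_fourierIntegral_smul_eq_flip (L := innerₗ ℝ)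
    Real.continuous_fourierChar continuous_inner J hg)

/-- The substitution `y = e^{-u}` makes the Mellin transform on `Re s = ρ` the Fourier transform of
this function. -/
theorem integrable_of_mellinConvergent {φ : ℝ → ℂ} {ρ : ℝ} (hφ : MellinConvergent φ ρ) :
    Integrable (fun u : ℝ => Real.exp (-ρ * u) • φ (Real.exp (-u))) := by
  have himg : (fun u : ℝ => Real.exp (-u)) '' univ = Ioi 0 := by
    ext y
    simp only [image_univ, mem_range, mem_Ioi]
    exact ⟨fun ⟨u, hu⟩ => hu ▸ Real.exp_pos _, fun hy => ⟨-Real.log y, by simp [Real.exp_log hy]⟩⟩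
  have hinj : InjOn (fun u : ℝ => Real.exp (-u)) univ := fun x _ y _ h => by
    simpa using Real.exp_injective h
  have hder : ∀ x ∈ univ, HasDerivWithinAt (fun u : ℝ => Real.exp (-u)) (-Real.exp (-x)) univ x :=
    fun x _ => by
      simpa [Function.comp_def] using
        ((Real.hasDerivAt_exp (-x)).comp x (hasDerivAt_neg x)).hasDerivWithinAt (s := univ)
  rw [MellinConvergent, ← himg,
    integrableOn_image_iff_integrableOn_abs_deriv_smul MeasurableSet.univ hder hinj,
    integrableOn_univ] at hφ
  refine hφ.congr (Eventually.of_forall fun u => ?_)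
  have h1 : (Real.exp (-u) : ℂ) ^ ((ρ : ℂ) - 1) = ((Real.exp (-u * (ρ - 1)) : ℝ) : ℂ) := by
    rw [Real.exp_mul, Complex.ofReal_cpow (Real.exp_pos _).le]; simp
  simp only [abs_neg, Real.abs_exp, h1]
  rw [Complex.coe_smul, smul_smul, ← Real.exp_add]
  ring_nf

/-- Gauss-Weierstrass inversion of the Mellin transform at a point of continuity. -/
theorem hasGaussMellinInv_of_ae_eq_mellin {φ : ℝ → ℂ} {ρ x : ℝ} (hx : 0 < x)
    (hφ : MellinConvergent φ ρ) (hc : ContinuousAt φ x) {V : ℂ → ℂ}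
    (hV : ∀ᵐ y : ℝ, V ((ρ : ℂ) + y * Complex.I) = mellin φ ((ρ : ℂ) + y * Complex.I)) :
    HasGaussMellinInv ρ V x (φ x) := by
  open scoped FourierTransform in
  set g : ℝ → ℂ := fun u : ℝ => Real.exp (-ρ * u) • φ (Real.exp (-u)) with hg
  have hgi : Integrable g := integrable_of_mellinConvergent hφ
  have hgc : ContinuousAt g (-Real.log x) := by
    refine ContinuousAt.fun_smul (by fun_prop) (ContinuousAt.comp ?_ (by fun_prop))
    simpa [Real.exp_log hx] using hc
  have hm : ∀ y : ℝ, mellin φ ((ρ : ℂ) + y * Complex.I) = 𝓕 g (y / (2 * Real.pi)) := by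
    intro y; rw [mellin_eq_fourier]; simp [hg]
  have hFc : Continuous (𝓕 g) := by
    exact VectorFourier.fourierIntegral_continuous Real.continuous_fourierChar
      (L := innerₗ ℝ) continuous_inner hgi
  have hx0 : (x : ℂ) ≠ 0 := Complex.ofReal_ne_zero.mpr hx.ne'
  have hVe : ∀ ε : ℝ, (fun y : ℝ => (Real.exp (-ε * y ^ 2) : ℂ) * invIntegrand ρ V x y) =ᵐ[volume]
      fun y : ℝ => (Real.exp (-ε * y ^ 2) : ℂ) *
        ((x : ℂ) ^ (-((ρ : ℂ) + y * Complex.I)) * 𝓕 g (y / (2 * Real.pi))) := fun ε => by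
    filter_upwards [hV] with y hy
    rw [invIntegrand, hy, hm]
  refine ⟨fun ε hε => ?_, ?_⟩
  · rw [integrable_congr (hVe ε)]
    refine Integrable.mono' ((integrable_exp_neg_mul_sq hε).mul_const
      (x ^ (-ρ) * ∫ u, ‖g u‖)) ?_ (Eventually.of_forall fun y => ?_)
    · refine Continuous.aestronglyMeasurable ?_
      have : Continuous fun y : ℝ => (x : ℂ) ^ (-((ρ : ℂ) + y * Complex.I)) :=
        Continuous.const_cpow (by fun_prop) (Or.inl hx0)
      fun_prop
    · rw [norm_mul, norm_mul, Complex.norm_cpow_eq_rpow_re_of_pos hx, Complex.norm_real,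
        Real.norm_of_nonneg (Real.exp_pos _).le]
      have : ‖𝓕 g (y / (2 * Real.pi))‖ ≤ ∫ u, ‖g u‖ :=
        VectorFourier.norm_fourierIntegral_le_integral_norm _ _ _ _ _
      simp only [Complex.neg_re, Complex.add_re, Complex.ofReal_re, Complex.mul_re, Complex.I_re,
        mul_zero, Complex.ofReal_im, Complex.I_im, mul_one, sub_self, add_zero]
      gcongr
  -- With `y = 2πw` the factor `e^{-εy²}` becomes `e^{-w²/c}` for `c = (4π²ε)⁻¹`.
  · have hlim : Tendsto (fun ε : ℝ => (4 * Real.pi ^ 2 * ε)⁻¹) (𝓝[>] 0) atTop := by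
      refine tendsto_inv_nhdsGT_zero.comp ?_
      refine tendsto_nhdsWithin_of_tendsto_nhds_of_eventually_within _ ?_ ?_
      · have : Tendsto (fun ε : ℝ => 4 * Real.pi ^ 2 * ε) (𝓝 0) (𝓝 (4 * Real.pi ^ 2 * 0)) :=
          tendsto_id.const_mul _
        rw [mul_zero] at this
        exact this.mono_left nhdsWithin_le_nhds
      · filter_upwards [self_mem_nhdsWithin] with ε (hε : 0 < ε)
        exact mem_Ioi.mpr (by positivity)
    have key := ((tendsto_integral_gaussian_mul_fourier hgi hgc).comp hlim).const_mul
      ((x : ℂ) ^ (-(ρ : ℂ)))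
    have hval : (x : ℂ) ^ (-(ρ : ℂ)) * g (-Real.log x) = φ x := by
      simp only [hg, neg_mul_neg, neg_neg, Real.exp_log hx, Complex.real_smul]
      rw [← mul_assoc, mul_comm ρ, Real.exp_mul, Real.exp_log hx, Complex.ofReal_cpow hx.le,
        ← Complex.cpow_add _ _ hx0]
      simp
    rw [hval] at key
    refine key.congr' ?_
    filter_upwards [self_mem_nhdsWithin] with ε (hε : 0 < ε)
    rw [integral_congr_ae (hVe ε)]
    have h2 := Measure.integral_comp_mul_left (fun y : ℝ => (Real.exp (-ε * y ^ 2) : ℂ) *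
        ((x : ℂ) ^ (-((ρ : ℂ) + y * Complex.I)) * 𝓕 g (y / (2 * Real.pi)))) (2 * Real.pi)
    have hπ : (0 : ℝ) < 2 * Real.pi := by positivity
    rw [abs_of_pos (inv_pos.mpr hπ), Complex.real_smul] at h2
    have h3 : (1 / (2 * Real.pi) : ℂ) = (((2 * Real.pi)⁻¹ : ℝ) : ℂ) := by push_cast; ring
    rw [h3, ← h2, Function.comp, ← integral_const_mul]
    congr 1 with w
    have h4 : 2 * Real.pi * w / (2 * Real.pi) = w := by field_simp
    rw [h4, smul_eq_mul, ← mul_assoc, ← mul_assoc]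
    congr 1
    rw [Complex.cpow_def_of_ne_zero hx0, Complex.cpow_def_of_ne_zero hx0, ← Complex.ofReal_log hx.le,
      ← Complex.exp_add, Complex.ofReal_exp, ← Complex.exp_add]
    congr 1
    have h5 : ((‖w‖ : ℝ) : ℂ) ^ 2 = (w : ℂ) ^ 2 := by
      rw [← Complex.ofReal_pow, Real.norm_eq_abs, sq_abs]; simp
    rw [h5]
    simp only [RCLike.inner_apply, conj_trivial]
    push_cast
    rw [inv_inv]
    ring

/-! ### Mellin transform of a superposition of dilates. -/

/-- Fubini's theorem for superpositions of dilates and the Mellin transform. -/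
theorem mellin_integral_mul_comp_mul {w : ℝ → ℂ} {c g : ℝ → ℝ} {k : ℝ → ℝ → ℂ} {s : ℂ}
    (hm : AEStronglyMeasurable (fun p : ℝ × ℝ => (p.2 : ℂ) ^ (s - 1) * (w p.1 * k p.1 (c p.1 * p.2)))
      ((volume.restrict (Ioi 0)).prod (volume.restrict (Ioi 0))))
    (hc : ∀ t, 0 < t → 0 < c t) (hk : ∀ t, 0 < t → MellinConvergent (k t) s)
    (hg : IntegrableOn g (Ioi 0))
    (hb : ∀ t, 0 < t →
      ‖w t‖ * c t ^ (-s.re) * ∫ x in Ioi (0 : ℝ), x ^ (s.re - 1) * ‖k t x‖ ≤ g t) :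
    MellinConvergent (fun x => ∫ t in Ioi (0 : ℝ), w t * k t (c t * x)) s ∧
    mellin (fun x => ∫ t in Ioi (0 : ℝ), w t * k t (c t * x)) s =
      ∫ t in Ioi (0 : ℝ), w t * (c t : ℂ) ^ (-s) * mellin (k t) s := by
  have hint : Integrable (fun p : ℝ × ℝ => (p.2 : ℂ) ^ (s - 1) * (w p.1 * k p.1 (c p.1 * p.2)))
      ((volume.restrict (Ioi 0)).prod (volume.restrict (Ioi 0))) := by
    rw [integrable_prod_iff hm]
    constructor
    · filter_upwards [ae_restrict_mem measurableSet_Ioi] with t ht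
      have := ((MellinConvergent.comp_mul_left (hc t ht)).2 (hk t ht)).const_smul (w t)
      exact this
    · refine Integrable.mono' hg hm.norm.integral_prod_right' ?_
      filter_upwards [ae_restrict_mem measurableSet_Ioi] with t ht
      rw [Real.norm_of_nonneg (integral_nonneg fun x => norm_nonneg _)]
      refine le_trans (le_of_eq (Eq.symm ?_)) (hb t ht)
      -- The scaling rule, applied to the norm of `k t` at the real exponent `s.re`, evaluates the
      -- inner integral in Tonelli's criterion.
      have h1 := mellin_comp_mul_left (fun x => ((‖k t x‖ : ℝ) : ℂ)) (s.re : ℂ) (hc t ht)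
      have h2 : ∀ q : ℝ → ℝ, mellin (fun x => ((q x : ℝ) : ℂ)) (s.re : ℂ) =
          ((∫ x in Ioi (0 : ℝ), x ^ (s.re - 1) * q x : ℝ) : ℂ) := by
        intro q
        rw [mellin, ← integral_complex_ofReal]
        refine setIntegral_congr_fun measurableSet_Ioi fun x hx => ?_
        simp only [smul_eq_mul, Complex.ofReal_mul]
        rw [Complex.ofReal_cpow (le_of_lt hx)]
        simp
      rw [h2, h2 (fun x => ‖k t x‖)] at h1
      have h3 : ((c t : ℂ)) ^ (-(s.re : ℂ)) = ((c t ^ (-s.re) : ℝ) : ℂ) := by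
        rw [Complex.ofReal_cpow (hc t ht).le]; simp
      rw [h3, smul_eq_mul, ← Complex.ofReal_mul, Complex.ofReal_inj] at h1
      rw [mul_assoc, ← h1, ← integral_const_mul]
      refine setIntegral_congr_fun measurableSet_Ioi fun x hx => ?_
      simp only [norm_mul]
      rw [Complex.norm_cpow_eq_rpow_re_of_pos hx]
      simp only [Complex.sub_re, Complex.one_re]
      ring
  have e : ∀ x : ℝ, (x : ℂ) ^ (s - 1) * ∫ t in Ioi (0 : ℝ), w t * k t (c t * x) =
      ∫ t in Ioi (0 : ℝ), (x : ℂ) ^ (s - 1) * (w t * k t (c t * x)) := fun x =>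
    (integral_const_mul _ _).symm
  constructor
  · refine (hint.integral_prod_right).congr (Eventually.of_forall fun x => ?_)
    exact (e x).symm
  · rw [mellin]
    simp only [smul_eq_mul, e]
    rw [← integral_integral_swap (f := fun t x : ℝ => (x : ℂ) ^ (s - 1) * (w t * k t (c t * x))) hint]
    refine setIntegral_congr_fun measurableSet_Ioi fun t ht => ?_
    have := mellin_comp_mul_left (k t) s (hc t ht)
    rw [mul_assoc, ← smul_eq_mul ((c t : ℂ) ^ (-s)), ← this, mellin, ← integral_const_mul]
    refine integral_congr_ae (Eventually.of_forall fun x => ?_)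
    simp only [smul_eq_mul]; ring

/-! ### Gauss means compared with symmetric partial integrals. -/

theorem hasDerivAt_neg_exp_neg_sq (x : ℝ) :
    HasDerivAt (fun B : ℝ => -Real.exp (-B ^ 2)) (2 * x * Real.exp (-x ^ 2)) x := by
  have := (((hasDerivAt_id x).fun_pow 2).fun_neg.exp).fun_neg
  refine this.congr_deriv ?_
  simp; ring

theorem tendsto_neg_exp_neg_sq : Tendsto (fun B : ℝ => -Real.exp (-B ^ 2)) atTop (𝓝 0) := by
  have : Tendsto (fun B : ℝ => -B ^ 2) atTop atBot :=
    tendsto_neg_atTop_atBot.comp (tendsto_pow_atTop two_ne_zero)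
  simpa using (Real.tendsto_exp_atBot.comp this).neg

theorem integrableOn_mul_exp_neg_sq {a : ℝ} (ha : 0 ≤ a) :
    IntegrableOn (fun B : ℝ => 2 * B * Real.exp (-B ^ 2)) (Ioi a) :=
  integrableOn_Ioi_deriv_of_nonneg' (fun x _ => hasDerivAt_neg_exp_neg_sq x)
    (fun x hx => by have : 0 < x := ha.trans_lt hx; positivity) tendsto_neg_exp_neg_sq

/-- The weight is a probability density on the half-line with Gaussian tails; at `a = √ε |y|` the
tail is the factor `e^{-εy²}`. -/
theorem integral_mul_exp_neg_sq {a : ℝ} (ha : 0 ≤ a) :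
    ∫ B in Ioi a, 2 * B * Real.exp (-B ^ 2) = Real.exp (-a ^ 2) := by
  rw [integral_Ioi_of_hasDerivAt_of_tendsto' (fun x _ => hasDerivAt_neg_exp_neg_sq x)
    (integrableOn_mul_exp_neg_sq ha) tendsto_neg_exp_neg_sq]
  simp

/-- Gauss means are averages of the symmetric partial integrals. -/
theorem integral_exp_neg_mul_sq_mul_eq {q : ℝ → ℂ} {ε : ℝ} (hε : 0 < ε)
    (hq : Integrable fun y : ℝ => (Real.exp (-ε * y ^ 2) : ℂ) * q y) :
    ∫ y : ℝ, (Real.exp (-ε * y ^ 2) : ℂ) * q y =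
      ∫ B in Ioi (0 : ℝ), ((2 * B * Real.exp (-B ^ 2) : ℝ) : ℂ) *
        ∫ y in (-(B / √ε))..(B / √ε), q y := by
  have hs : 0 < √ε := Real.sqrt_pos.2 hε
  have hqm : AEStronglyMeasurable q volume := by
    have h1 : AEStronglyMeasurable (fun y : ℝ => ((Real.exp (ε * y ^ 2) : ℝ) : ℂ)) volume :=
      Continuous.aestronglyMeasurable (by fun_prop)
    refine (h1.mul hq.aestronglyMeasurable).congr (Eventually.of_forall fun y => ?_)
    simp only [Pi.mul_apply]
    rw [← mul_assoc, ← Complex.ofReal_mul, ← Real.exp_add]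
    simp
  -- Integrating over `B` first gives the Gaussian factor, over `y` first the partial integral on
  -- `|y| < B/√ε`.
  set S : Set (ℝ × ℝ) := {p | √ε * |p.1| < p.2} with hS
  have hSm : MeasurableSet S := (isOpen_lt (by fun_prop) (by fun_prop)).measurableSet
  set K : ℝ → ℝ → ℂ := fun y B => S.indicator
    (fun p : ℝ × ℝ => ((2 * p.2 * Real.exp (-p.2 ^ 2) : ℝ) : ℂ) * q p.1) (y, B) with hK
  have hKin : ∀ y B, K y B = (Ioi (√ε * |y|)).indicator
      (fun B => ((2 * B * Real.exp (-B ^ 2) : ℝ) : ℂ) * q y) B := fun y B => by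
    simp only [hK, hS, indicator, mem_ofPred_eq, mem_Ioi]
  have hexp : ∀ y : ℝ, Real.exp (-(√ε * |y|) ^ 2) = Real.exp (-ε * y ^ 2) := fun y => by
    rw [mul_pow, Real.sq_sqrt hε.le, sq_abs, neg_mul]
  have hsub : ∀ y : ℝ, Ioi (√ε * |y|) ∩ Ioi 0 = Ioi (√ε * |y|) := fun y =>
    inter_eq_left.2 (Ioi_subset_Ioi (by positivity))
  have hint : Integrable (Function.uncurry K) (volume.prod (volume.restrict (Ioi 0))) := by
    have hm : AEStronglyMeasurable (Function.uncurry K) (volume.prod (volume.restrict (Ioi 0))) := by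
      refine AEStronglyMeasurable.indicator ?_ hSm
      refine AEStronglyMeasurable.mul (Continuous.aestronglyMeasurable (by fun_prop)) ?_
      exact hqm.comp_fst
    rw [integrable_prod_iff hm]
    constructor
    · refine Eventually.of_forall fun y => ?_
      simp only [Function.uncurry, hKin]
      rw [integrable_indicator_iff measurableSet_Ioi, IntegrableOn,
        Measure.restrict_restrict measurableSet_Ioi, hsub]
      exact ((integrableOn_mul_exp_neg_sq (by positivity)).ofReal).mul_const _
    · refine hq.norm.congr (Eventually.of_forall fun y => ?_)
      simp only [Function.uncurry, hKin, norm_indicator_eq_indicator_norm]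
      rw [integral_indicator measurableSet_Ioi, Measure.restrict_restrict measurableSet_Ioi, hsub,
        norm_mul, Complex.norm_real, Real.norm_of_nonneg (Real.exp_pos _).le, ← hexp,
        ← integral_mul_exp_neg_sq (by positivity), ← integral_mul_const]
      refine setIntegral_congr_fun measurableSet_Ioi fun B hB => ?_
      have : 0 ≤ B := (by positivity : 0 ≤ √ε * |y|).trans (le_of_lt hB)
      rw [norm_mul, Complex.norm_real, Real.norm_of_nonneg (by positivity)]
  have h1 : ∀ y, (Real.exp (-ε * y ^ 2) : ℂ) * q y = ∫ B in Ioi (0 : ℝ), K y B := fun y => by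
    simp only [hKin]
    rw [integral_indicator measurableSet_Ioi, Measure.restrict_restrict measurableSet_Ioi, hsub,
      integral_mul_const, integral_complex_ofReal, integral_mul_exp_neg_sq (by positivity), hexp]
  rw [integral_congr_ae (Eventually.of_forall h1), integral_integral_swap hint]
  refine setIntegral_congr_fun measurableSet_Ioi fun B (hB : 0 < B) => ?_
  have hle : -(B / √ε) ≤ B / √ε := by linarith [div_pos hB hs]
  rw [intervalIntegral.integral_of_le hle, ← integral_const_mul, integral_Ioc_eq_integral_Ioo,
    ← integral_indicator measurableSet_Ioo]
  congr 1 with y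
  have : (y, B) ∈ S ↔ y ∈ Ioo (-(B / √ε)) (B / √ε) := by
    rw [mem_Ioo, ← abs_lt, lt_div_iff₀ hs, mul_comm]; rfl
  by_cases h : (y, B) ∈ S
  · simp only [hK, indicator_of_mem h, indicator_of_mem (this.1 h)]
  · simp only [hK, indicator_of_notMem h, indicator_of_notMem (fun h' => h (this.2 h'))]

/-- Convergence of the symmetric partial integrals implies convergence of the Gauss means. -/
theorem tendsto_gauss_of_tendsto_integral {q : ℝ → ℂ} {v : ℂ}
    (hq : ∀ ε : ℝ, 0 < ε → Integrable fun y : ℝ => (Real.exp (-ε * y ^ 2) : ℂ) * q y)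
    (hqi : ∀ A : ℝ, IntervalIntegrable q volume (-A) A)
    (h : Tendsto (fun A : ℝ => ∫ y in (-A)..A, q y) atTop (𝓝 v)) :
    Tendsto (fun ε : ℝ => ∫ y : ℝ, (Real.exp (-ε * y ^ 2) : ℂ) * q y) (𝓝[>] 0) (𝓝 v) := by
  have hqi' : ∀ a b : ℝ, IntervalIntegrable q volume a b := fun a b => by
    refine (hqi (max |a| |b|)).mono_set ?_
    have h1 : -max |a| |b| ≤ max |a| |b| := by
      have := abs_nonneg a
      have := le_max_left |a| |b|
      linarith
    rw [uIcc_of_le h1]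
    refine uIcc_subset_Icc ⟨?_, ?_⟩ ⟨?_, ?_⟩
    · linarith [neg_abs_le a, le_max_left |a| |b|]
    · linarith [le_abs_self a, le_max_left |a| |b|]
    · linarith [neg_abs_le b, le_max_right |a| |b|]
    · linarith [le_abs_self b, le_max_right |a| |b|]
  have hQc : Continuous fun A : ℝ => ∫ y in (-A)..A, q y := by
    have h0 : Continuous fun A : ℝ => ∫ y in (0 : ℝ)..A, q y :=
      intervalIntegral.continuous_primitive hqi' 0
    have : (fun A : ℝ => ∫ y in (-A)..A, q y) =
        fun A : ℝ => (∫ y in (0 : ℝ)..A, q y) - ∫ y in (0 : ℝ)..(-A), q y := by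
      ext A
      rw [intervalIntegral.integral_interval_sub_left (hqi' _ _) (hqi' _ _)]
    rw [this]
    exact h0.sub (h0.comp continuous_neg)
  -- Bounded for large `A` by convergence, for the remaining `A` by continuity on a compact
  -- interval.
  obtain ⟨M, hM⟩ : ∃ M : ℝ, ∀ A : ℝ, 0 ≤ A → ‖∫ y in (-A)..A, q y‖ ≤ M := by
    obtain ⟨A₀, hA₀⟩ := (eventually_atTop.1 (h.norm.eventually (ge_mem_nhds (lt_add_one ‖v‖))))
    obtain ⟨M₁, hM₁⟩ := (isCompact_Icc (a := (0 : ℝ)) (b := A₀)).exists_bound_of_continuousOn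
      hQc.continuousOn
    refine ⟨max M₁ (‖v‖ + 1), fun A hA => ?_⟩
    rcases le_total A A₀ with h1 | h1
    · exact (hM₁ A ⟨hA, h1⟩).trans (le_max_left _ _)
    · exact (hA₀ A h1).trans (le_max_right _ _)
  have hlim : Tendsto (fun ε : ℝ => ∫ B in Ioi (0 : ℝ), ((2 * B * Real.exp (-B ^ 2) : ℝ) : ℂ) *
        ∫ y in (-(B / √ε))..(B / √ε), q y) (𝓝[>] 0)
      (𝓝 (∫ B in Ioi (0 : ℝ), ((2 * B * Real.exp (-B ^ 2) : ℝ) : ℂ) * v)) := by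
    refine tendsto_integral_filter_of_dominated_convergence
      (fun B => 2 * B * Real.exp (-B ^ 2) * M) ?_ ?_ ((integrableOn_mul_exp_neg_sq le_rfl).mul_const M) ?_
    · refine Eventually.of_forall fun ε => ?_
      have := hQc.comp (continuous_id.div_const (√ε))
      exact (Continuous.mul (by fun_prop) this).aestronglyMeasurable
    · refine Eventually.of_forall fun ε => ?_
      filter_upwards [ae_restrict_mem measurableSet_Ioi] with B (hB : 0 < B)
      rw [norm_mul, Complex.norm_real, Real.norm_of_nonneg (by positivity)]
      gcongr
      exact hM _ (by positivity)
    · filter_upwards [ae_restrict_mem measurableSet_Ioi] with B (hB : 0 < B)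
      refine Tendsto.const_mul _ (h.comp ?_)
      refine Tendsto.const_mul_atTop hB (tendsto_inv_nhdsGT_zero.comp ?_)
      refine tendsto_nhdsWithin_of_tendsto_nhds_of_eventually_within _ ?_ ?_
      · have : Tendsto (fun ε : ℝ => √ε) (𝓝 0) (𝓝 √0) := Real.continuous_sqrt.tendsto 0
        rw [Real.sqrt_zero] at this
        exact this.mono_left nhdsWithin_le_nhds
      · filter_upwards [self_mem_nhdsWithin] with ε (hε : 0 < ε)
        exact Real.sqrt_pos.2 hε
  rw [integral_mul_const, integral_complex_ofReal, integral_mul_exp_neg_sq le_rfl] at hlim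
  simp only [ne_eq, OfNat.ofNat_ne_zero, not_false_eq_true, zero_pow, neg_zero, Real.exp_zero,
    Complex.ofReal_one, one_mul] at hlim
  refine hlim.congr' ?_
  filter_upwards [self_mem_nhdsWithin] with ε (hε : 0 < ε)
  exact (integral_exp_neg_mul_sq_mul_eq hε (hq ε hε)).symm

/-- A convergent Mellin inversion integral has the same value as its Gauss means. -/
theorem HasMellinInv.eq_of_hasGaussMellinInv {ρ : ℝ} {V : ℂ → ℂ} {x : ℝ} {v w : ℂ}
    (h : HasMellinInv ρ V x v) (hg : HasGaussMellinInv ρ V x w) : v = w := by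
  have hπ : (1 / (2 * Real.pi) : ℂ) ≠ 0 := by simp [Real.pi_ne_zero]
  have h1 : Tendsto (fun A : ℝ => ∫ y in (-A)..A, invIntegrand ρ V x y) atTop
      (𝓝 ((1 / (2 * Real.pi) : ℂ)⁻¹ * v)) := by
    refine (h.2.const_mul (1 / (2 * Real.pi) : ℂ)⁻¹).congr fun A => ?_
    rw [inv_mul_cancel_left₀ hπ]
  have h2 := (tendsto_gauss_of_tendsto_integral hg.1 h.1 h1).const_mul (1 / (2 * Real.pi) : ℂ)
  rw [mul_inv_cancel_left₀ hπ] at h2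
  exact tendsto_nhds_unique h2 hg.2

/-! ### The kernel integral `I_n`: convergence, holomorphy and zeros. -/

theorem nPrime_nonneg (n : ℤ) : 0 ≤ nPrime n := by
  rw [nPrime]; exact_mod_cast le_max_left _ _

theorem add_one_le_nPrime (n : ℤ) : (n : ℝ) + 1 ≤ nPrime n := by
  rw [nPrime]; exact_mod_cast le_max_right 0 (n + 1)

/-- Comparison with `t^{-σ}` on `(0, 1]` and with `t^{2p-σ}` on `(1, ∞)`. -/
theorem integrableOn_one_add_sq_rpow_mul_rpow {p σ : ℝ} (hp : p ≤ 0) (hσ : σ < 1)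
    (h : 2 * p - σ < -1) :
    IntegrableOn (fun t : ℝ => (1 + t ^ 2) ^ p * t ^ (-σ)) (Ioi 0) := by
  have hcont : ContinuousOn (fun t : ℝ => (1 + t ^ 2) ^ p * t ^ (-σ)) (Ioi 0) := by
    refine ContinuousOn.mul (ContinuousOn.rpow_const (by fun_prop) fun t _ => Or.inl (by positivity))
      (ContinuousOn.rpow_const (by fun_prop) fun t ht => Or.inl (ne_of_gt ht))
  rw [← Ioc_union_Ioi_eq_Ioi zero_le_one]
  refine IntegrableOn.union ?_ ?_
  · have h1 : IntegrableOn (fun t : ℝ => t ^ (-σ)) (Ioc 0 1) :=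
      (intervalIntegrable_iff_integrableOn_Ioc_of_le zero_le_one).1
        (intervalIntegral.intervalIntegrable_rpow' (by linarith))
    have h2 : ContinuousOn (fun t : ℝ => (1 + t ^ 2) ^ p * t ^ (-σ)) (Ioc 0 1) :=
      hcont.mono Ioc_subset_Ioi_self
    refine Integrable.mono' h1 (h2.aestronglyMeasurable measurableSet_Ioc) ?_
    filter_upwards [ae_restrict_mem measurableSet_Ioc] with t ht
    have ht0 : 0 < t := ht.1
    rw [Real.norm_of_nonneg (by positivity)]
    refine mul_le_of_le_one_left (by positivity) (Real.rpow_le_one_of_one_le_of_nonpos ?_ hp)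
    nlinarith [sq_nonneg t]
  · have h2 : ContinuousOn (fun t : ℝ => (1 + t ^ 2) ^ p * t ^ (-σ)) (Ioi 1) :=
      hcont.mono (Ioi_subset_Ioi zero_le_one)
    refine Integrable.mono' (integrableOn_Ioi_rpow_of_lt h zero_lt_one)
      (h2.aestronglyMeasurable measurableSet_Ioi) ?_
    filter_upwards [ae_restrict_mem measurableSet_Ioi] with t ht
    have ht0 : 0 < t := zero_lt_one.trans ht
    rw [Real.norm_of_nonneg (by positivity), sub_eq_add_neg, Real.rpow_add ht0]
    gcongr
    rw [Real.rpow_mul ht0.le]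
    refine Real.rpow_le_rpow_of_nonpos (by positivity) ?_ hp
    norm_num

theorem norm_one_add_I_mul (t : ℝ) : ‖1 + Complex.I * (t : ℂ)‖ = √(1 + t ^ 2) := by
  rw [Complex.norm_eq_sqrt_sq_add_sq]; simp

theorem norm_one_add_I_mul_zpow (t : ℝ) (n : ℤ) :
    ‖(1 + Complex.I * (t : ℂ)) ^ n‖ = (1 + t ^ 2) ^ ((n : ℝ) / 2) := by
  rw [norm_zpow, norm_one_add_I_mul, Real.sqrt_eq_rpow, ← Real.rpow_intCast,
    ← Real.rpow_mul (by positivity)]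
  congr 1; ring

theorem one_add_I_mul_ne_zero (t : ℝ) : (1 + Complex.I * (t : ℂ)) ≠ 0 := by
  rw [← norm_ne_zero_iff, norm_one_add_I_mul]; positivity

theorem norm_kernelI (n : ℤ) (ζ ξ : ℂ) {t : ℝ} (ht : 0 < t) :
    ‖kernelI n ζ ξ t‖ = (1 + t ^ 2) ^ ((n - ζ.re) / 2) * t ^ (-ξ.re) := by
  have h : 0 < 1 + t ^ 2 := by positivity
  rw [kernelI, norm_mul, norm_mul, norm_one_add_I_mul_zpow, Complex.norm_cpow_eq_rpow_re_of_pos h,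
    Complex.norm_cpow_eq_rpow_re_of_pos ht, mul_right_comm, ← Real.rpow_add h]
  have : (-ζ / 2).re = -ζ.re / 2 := by simp
  rw [this, Complex.neg_re]
  congr 2; ring

theorem continuousOn_kernelI (n : ℤ) (ζ ξ : ℂ) : ContinuousOn (kernelI n ζ ξ) (Ioi 0) := by
  refine ContinuousOn.mul (ContinuousOn.mul ?_ ?_) ?_
  · refine ContinuousOn.cpow_const (by fun_prop) fun t _ => Complex.ofReal_mem_slitPlane.2 ?_
    positivity
  · exact ContinuousOn.cpow_const (by fun_prop) fun t ht => Complex.ofReal_mem_slitPlane.2 ht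
  · exact ContinuousOn.zpow₀ (by fun_prop) _ fun t _ => Or.inl (one_add_I_mul_ne_zero t)

theorem aestronglyMeasurable_kernelI (n : ℤ) (ζ ξ : ℂ) :
    AEStronglyMeasurable (kernelI n ζ ξ) (volume.restrict (Ioi 0)) :=
  (continuousOn_kernelI n ζ ξ).aestronglyMeasurable measurableSet_Ioi

theorem integrableOn_kernelI {n : ℤ} {ζ ξ : ℂ} (hζ : nPrime n < ζ.re) (h0 : 0 < ξ.re)
    (h1 : ξ.re < 1) : IntegrableOn (kernelI n ζ ξ) (Ioi 0) := by
  have := add_one_le_nPrime n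
  rw [IntegrableOn, ← integrable_norm_iff (aestronglyMeasurable_kernelI n ζ ξ)]
  refine IntegrableOn.congr_fun
    (integrableOn_one_add_sq_rpow_mul_rpow (p := (n - ζ.re) / 2) (σ := ξ.re) (by linarith) h1
      (by linarith)) (fun t ht => (norm_kernelI n ζ ξ ht).symm) measurableSet_Ioi

theorem hasDerivAt_kernelI (n : ℤ) (ζ ξ : ℂ) (t : ℝ) :
    HasDerivAt (fun z => kernelI n z ξ t)
      (((-(Real.log (1 + t ^ 2) / 2) : ℝ) : ℂ) * kernelI n ζ ξ t) ζ := by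
  have h : (0 : ℝ) < 1 + t ^ 2 := by positivity
  have h1 : HasDerivAt (fun z : ℂ => -z / 2) (-1 / 2) ζ := (hasDerivAt_id ζ).fun_neg.div_const 2
  have h2 := ((h1.const_cpow (c := ((1 + t ^ 2 : ℝ) : ℂ))
    (Or.inl (Complex.ofReal_ne_zero.2 h.ne'))).mul_const ((t : ℂ) ^ (-ξ))).mul_const
      ((1 + Complex.I * (t : ℂ)) ^ n)
  refine h2.congr_deriv ?_
  rw [kernelI, ← Complex.ofReal_log h.le]
  push_cast
  ring

theorem differentiableAt_integralI {n : ℤ} {ζ ξ : ℂ} (hζ : nPrime n < ζ.re) (h0 : 0 < ξ.re)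
    (h1 : ξ.re < 1) : DifferentiableAt ℂ (fun z => integralI n z ξ) ζ := by
  have hn := add_one_le_nPrime n
  -- The dominating exponent loses `δ` to the radius of the ball and `2δ` to the logarithm,
  -- estimated by `log x ≤ x^δ/δ`; a quarter of the gap leaves room for `3δ`.
  set δ := (ζ.re - nPrime n) / 4 with hδ
  have hδ0 : 0 < δ := by rw [hδ]; linarith
  refine (hasDerivAt_integral_of_dominated_loc_of_deriv_le (μ := volume.restrict (Ioi (0 : ℝ)))
    (F := fun z t => kernelI n z ξ t)
    (F' := fun z t => ((-(Real.log (1 + t ^ 2) / 2) : ℝ) : ℂ) * kernelI n z ξ t)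
    (bound := fun t => (2 * δ)⁻¹ * ((1 + t ^ 2) ^ ((n - ζ.re + 3 * δ) / 2) * t ^ (-ξ.re)))
    (Metric.ball_mem_nhds ζ hδ0)
    (Eventually.of_forall fun z => aestronglyMeasurable_kernelI n z ξ)
    (integrableOn_kernelI hζ h0 h1) ?_ ?_ ?_ ?_).2.differentiableAt
  · refine AEStronglyMeasurable.mul ?_ (aestronglyMeasurable_kernelI n ζ ξ)
    refine Continuous.aestronglyMeasurable (Complex.continuous_ofReal.comp ?_)
    refine ((Continuous.log (by fun_prop) fun t => ?_).div_const 2).neg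
    positivity
  · filter_upwards [ae_restrict_mem measurableSet_Ioi] with t ht z hz
    have ht0 : 0 < t := ht
    have h : (1 : ℝ) ≤ 1 + t ^ 2 := by nlinarith [sq_nonneg t]
    have hlog : 0 ≤ Real.log (1 + t ^ 2) := Real.log_nonneg h
    have hz' : ζ.re - δ ≤ z.re := by
      have h3 := (Complex.abs_re_le_norm (z - ζ)).trans (mem_ball_iff_norm.1 hz).le
      rw [Complex.sub_re] at h3
      linarith [neg_abs_le (z.re - ζ.re)]
    rw [norm_mul, norm_kernelI n z ξ ht0, Complex.norm_real, norm_neg,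
      Real.norm_of_nonneg (by positivity), ← mul_assoc, ← mul_assoc]
    refine mul_le_mul_of_nonneg_right ?_ (by positivity)
    calc Real.log (1 + t ^ 2) / 2 * (1 + t ^ 2) ^ ((n - z.re) / 2)
        ≤ ((1 + t ^ 2) ^ δ / δ) / 2 * (1 + t ^ 2) ^ ((n - ζ.re + δ) / 2) := by
          gcongr
          · exact Real.log_le_rpow_div (by positivity) hδ0
          · linarith
      _ = (2 * δ)⁻¹ * ((1 + t ^ 2) ^ δ * (1 + t ^ 2) ^ ((n - ζ.re + δ) / 2)) := by
          field_simp
      _ = (2 * δ)⁻¹ * (1 + t ^ 2) ^ ((n - ζ.re + 3 * δ) / 2) := by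
          rw [← Real.rpow_add (by positivity)]; congr 2; ring
  · refine (integrableOn_one_add_sq_rpow_mul_rpow ?_ h1 ?_).const_mul _ <;> rw [hδ] <;> linarith
  · exact Eventually.of_forall fun t z _ => hasDerivAt_kernelI n z ξ t

/-- The rescaled integrand of `integralI`, on the scale of the Gaussian approximation. -/
noncomputable def scaledKernel (n : ℤ) (ξ : ℂ) (z u : ℝ) : ℂ :=
  (u : ℂ) ^ (-ξ) * (((1 + u ^ 2 / z) ^ (-z / 2) : ℝ) : ℂ) * (1 + Complex.I * ((u / √z : ℝ) : ℂ)) ^ n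

/-- The substitution `t = u/√z` changes the integral only by a nonzero factor. -/
theorem integral_scaledKernel_eq_zero {n : ℤ} {ξ : ℂ} {z : ℝ} (hz : 0 < z)
    (h : integralI n z ξ = 0) : ∫ u in Ioi (0 : ℝ), scaledKernel n ξ z u = 0 := by
  have hs : 0 < (√z)⁻¹ := inv_pos.2 (Real.sqrt_pos.2 hz)
  have h1 := integral_comp_mul_left_Ioi (kernelI n z ξ) 0 hs
  rw [mul_zero, ← integralI, h, smul_zero] at h1
  have h2 : ∀ u ∈ Ioi (0 : ℝ), kernelI n z ξ ((√z)⁻¹ * u) =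
      ((√z)⁻¹ : ℝ) ^ (-ξ) * scaledKernel n ξ z u := fun u hu => by
    have hu0 : 0 < u := hu
    have e1 : 1 + ((√z)⁻¹ * u) ^ 2 = 1 + u ^ 2 / z := by
      rw [mul_pow, inv_pow, Real.sq_sqrt hz.le]; ring
    have e2 : (√z)⁻¹ * u = u / √z := by ring
    have e3 : (((√z)⁻¹ * u : ℝ) : ℂ) ^ (-ξ) = (((√z)⁻¹ : ℝ) : ℂ) ^ (-ξ) * (u : ℂ) ^ (-ξ) := by
      rw [Complex.ofReal_mul, Complex.mul_cpow_ofReal_nonneg hs.le hu0.le]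
    rw [kernelI, e3, e1, e2, scaledKernel, Complex.ofReal_cpow (by positivity)]
    push_cast
    ring
  rw [setIntegral_congr_fun measurableSet_Ioi h2, integral_const_mul, mul_eq_zero] at h1
  refine h1.resolve_left ?_
  rw [Complex.cpow_eq_zero_iff, not_and_or]
  exact Or.inl (Complex.ofReal_ne_zero.2 hs.ne')

/-- In the variable `u²` this is a nonzero multiple of `Γ((1-ξ)/2)`, and `Γ` has no zeros. -/
theorem integral_cpow_mul_exp_neg_sq_ne_zero {ξ : ℂ} (h1 : ξ.re < 1) :
    ∫ u in Ioi (0 : ℝ), (u : ℂ) ^ (-ξ) * ((Real.exp (-u ^ 2 / 2) : ℝ) : ℂ) ≠ 0 := by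
  have hre : 0 < ((1 - ξ) / 2).re := by simp; linarith
  have e1 : ∫ u in Ioi (0 : ℝ), (u : ℂ) ^ (-ξ) * ((Real.exp (-u ^ 2 / 2) : ℝ) : ℂ) =
      mellin (fun u : ℝ => (fun x : ℝ => Complex.exp (-(((1 / 2 : ℝ) : ℂ) * x))) (u ^ (2 : ℝ))) (1 - ξ) := by
    rw [mellin]
    refine setIntegral_congr_fun measurableSet_Ioi fun u hu => ?_
    simp only [smul_eq_mul, Real.rpow_two]
    congr 2
    · ring
    · push_cast; congr 1; ring
  have e2 : mellin (fun x : ℝ => Complex.exp (-(((1 / 2 : ℝ) : ℂ) * x))) ((1 - ξ) / 2) ≠ 0 := by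
    simp only [mellin, smul_eq_mul]
    rw [Complex.integral_cpow_mul_exp_neg_mul_Ioi hre one_half_pos]
    refine mul_ne_zero ?_ (Complex.Gamma_ne_zero_of_re_pos hre)
    rw [Ne, Complex.cpow_eq_zero_iff, not_and_or]
    left; norm_num
  have e3 := mellin_comp_rpow
    (fun x : ℝ => Complex.exp (-(((1 / 2 : ℝ) : ℂ) * x))) (1 - ξ) 2
  rw [e1, e3]
  exact smul_ne_zero (by norm_num) (by exact_mod_cast e2)

/-- Bernoulli's inequality with exponent `z/z₀ ≥ 1`; it supplies a majorant uniform in `z`. -/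
theorem one_add_div_rpow_neg_le {z z₀ u : ℝ} (hz₀ : 0 < z₀) (h : z₀ ≤ z) :
    (1 + u ^ 2 / z) ^ (-z / 2) ≤ (1 + u ^ 2 / z₀) ^ (-z₀ / 2) := by
  have hz : 0 < z := hz₀.trans_le h
  have h1 : 1 + u ^ 2 / z₀ ≤ (1 + u ^ 2 / z) ^ (z / z₀) := by
    have := one_add_mul_self_le_rpow_one_add (s := u ^ 2 / z) (p := z / z₀)
      (by linarith [show 0 ≤ u ^ 2 / z by positivity]) ((one_le_div hz₀).2 h)
    refine le_trans (le_of_eq ?_) this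
    field_simp
  have h2 : (1 + u ^ 2 / z) ^ (-z / 2) = ((1 + u ^ 2 / z) ^ (z / z₀)) ^ (-z₀ / 2) := by
    rw [← Real.rpow_mul (by positivity)]
    congr 1; field_simp
  rw [h2]
  exact Real.rpow_le_rpow_of_nonpos (by positivity) h1 (by linarith)

theorem continuousOn_scaledKernel (n : ℤ) (ξ : ℂ) {z : ℝ} (hz : 0 < z) :
    ContinuousOn (scaledKernel n ξ z) (Ioi 0) := by
  refine ContinuousOn.mul (ContinuousOn.mul ?_ ?_) ?_
  · exact ContinuousOn.cpow_const (by fun_prop) fun t ht => Complex.ofReal_mem_slitPlane.2 ht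
  · refine Complex.continuous_ofReal.comp_continuousOn ?_
    exact ContinuousOn.rpow_const (by fun_prop) fun t _ => Or.inl (by positivity)
  · exact ContinuousOn.zpow₀ (by fun_prop) _ fun t _ => Or.inl (one_add_I_mul_ne_zero _)

/-- Laplace's method: `(1 + u²/z)^{-z/2}` tends to `e^{-u²/2}` while `(1 + iu/√z)^n` tends to `1`.
-/
theorem tendsto_integral_scaledKernel (n : ℤ) {ξ : ℂ} (h0 : 0 < ξ.re) (h1 : ξ.re < 1) :
    Tendsto (fun z : ℝ => ∫ u in Ioi (0 : ℝ), scaledKernel n ξ z u) atTop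
      (𝓝 (∫ u in Ioi (0 : ℝ), (u : ℂ) ^ (-ξ) * ((Real.exp (-u ^ 2 / 2) : ℝ) : ℂ))) := by
  set m : ℝ := nPrime n with hm
  have hm0 : 0 ≤ m := nPrime_nonneg n
  have hmn : (n : ℝ) ≤ m := by linarith [add_one_le_nPrime n]
  -- The choice leaves the exponent `-z₀/2 + m/2 = -1` once the growth of the `n`-th power is
  -- absorbed.
  set z₀ : ℝ := m + 2 with hz₀
  have hz₀1 : 1 ≤ z₀ := by linarith
  have hz₀0 : 0 < z₀ := by linarith
  refine tendsto_integral_filter_of_dominated_convergence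
    (fun u => z₀ * ((1 + u ^ 2) ^ (-1 : ℝ) * u ^ (-ξ.re))) ?_ ?_ ?_ ?_
  · filter_upwards [eventually_gt_atTop 0] with z hz
    exact (continuousOn_scaledKernel n ξ hz).aestronglyMeasurable measurableSet_Ioi
  · filter_upwards [eventually_ge_atTop z₀] with z hz
    filter_upwards [ae_restrict_mem measurableSet_Ioi] with u (hu : 0 < u)
    have hz0 : 0 < z := hz₀0.trans_le hz
    have hx : 1 ≤ 1 + u ^ 2 / z₀ := le_add_of_nonneg_right (by positivity)
    rw [scaledKernel, norm_mul, norm_mul, Complex.norm_cpow_eq_rpow_re_of_pos hu, Complex.neg_re,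
      Complex.norm_real, Real.norm_of_nonneg (by positivity), norm_one_add_I_mul_zpow, div_pow,
      Real.sq_sqrt hz0.le]
    calc u ^ (-ξ.re) * (1 + u ^ 2 / z) ^ (-z / 2) * (1 + u ^ 2 / z) ^ ((n : ℝ) / 2)
        ≤ u ^ (-ξ.re) * (1 + u ^ 2 / z₀) ^ (-z₀ / 2) * (1 + u ^ 2 / z₀) ^ (m / 2) := by
          gcongr u ^ (-ξ.re) * ?_ * ?_
          · exact one_add_div_rpow_neg_le hz₀0 hz
          · calc (1 + u ^ 2 / z) ^ ((n : ℝ) / 2) ≤ (1 + u ^ 2 / z) ^ (m / 2) := by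
                  gcongr
                  exact le_add_of_nonneg_right (by positivity)
              _ ≤ (1 + u ^ 2 / z₀) ^ (m / 2) := by gcongr
      _ = u ^ (-ξ.re) * (1 + u ^ 2 / z₀) ^ (-1 : ℝ) := by
          rw [mul_assoc, ← Real.rpow_add (by positivity)]
          congr 2; rw [hz₀]; ring
      _ ≤ u ^ (-ξ.re) * (z₀ * (1 + u ^ 2) ^ (-1 : ℝ)) := by
          gcongr
          rw [Real.rpow_neg_one, Real.rpow_neg_one, ← div_eq_mul_inv,
            inv_le_comm₀ (by positivity) (by positivity), inv_div, add_div]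
          gcongr
          rw [div_le_one hz₀0]; exact hz₀1
      _ = _ := by ring
  · exact (integrableOn_one_add_sq_rpow_mul_rpow (by norm_num) h1 (by linarith)).const_mul _
  · filter_upwards [ae_restrict_mem measurableSet_Ioi] with u (hu : 0 < u)
    have l1 : Tendsto (fun z : ℝ => (1 + u ^ 2 / z) ^ (-z / 2)) atTop
        (𝓝 (Real.exp (-u ^ 2 / 2))) := by
      have := (Real.tendsto_one_add_div_rpow_exp (u ^ 2)).rpow_const (p := -1 / 2)
        (Or.inl (Real.exp_pos _).ne')
      rw [← Real.exp_mul] at this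
      have e : u ^ 2 * (-1 / 2) = -u ^ 2 / 2 := by ring
      rw [e] at this
      refine this.congr' ?_
      filter_upwards [eventually_gt_atTop 0] with z hz
      rw [← Real.rpow_mul (by positivity)]
      congr 1; ring
    have l2 : Tendsto (fun z : ℝ => (1 + Complex.I * ((u / √z : ℝ) : ℂ)) ^ n) atTop (𝓝 1) := by
      have a1 : Tendsto (fun z : ℝ => u / √z) atTop (𝓝 0) :=
        Real.tendsto_sqrt_atTop.const_div_atTop u
      have a2 : Tendsto (fun x : ℝ => (1 + Complex.I * (x : ℂ)) ^ n) (𝓝 0)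
          (𝓝 ((1 + Complex.I * ((0 : ℝ) : ℂ)) ^ n)) := by
        refine ContinuousAt.zpow₀ (by fun_prop) n (Or.inl (one_add_I_mul_ne_zero 0))
      simpa [Function.comp_def] using a2.comp a1
    have l3 := (((Complex.continuous_ofReal.tendsto _).comp l1).const_mul ((u : ℂ) ^ (-ξ))).mul l2
    rw [mul_one] at l3
    exact l3

theorem exists_integralI_ne_zero (n : ℤ) {ξ : ℂ} (h0 : 0 < ξ.re) (h1 : ξ.re < 1) :
    ∃ z : ℝ, nPrime n < z ∧ integralI n z ξ ≠ 0 := by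
  by_contra! hcon
  refine integral_cpow_mul_exp_neg_sq_ne_zero h1
    (tendsto_nhds_unique (tendsto_integral_scaledKernel n h0 h1) ?_)
  refine tendsto_const_nhds.congr' ?_
  filter_upwards [eventually_gt_atTop (nPrime n)] with z hz
  exact (integral_scaledKernel_eq_zero ((nPrime_nonneg n).trans_lt hz) (hcon z hz)).symm

/-- The kernel integral vanishes at most on a null set of each vertical line. -/
theorem ae_integralI_ne_zero {n : ℤ} {ρ : ℝ} (hρ : nPrime n < ρ) {ξ : ℂ} (h0 : 0 < ξ.re)
    (h1 : ξ.re < 1) : ∀ᵐ y : ℝ, integralI n ((ρ : ℂ) + y * Complex.I) ξ ≠ 0 := by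
  set D : Set ℂ := {ζ | nPrime n < ζ.re} with hD
  have hDo : IsOpen D := isOpen_lt continuous_const Complex.continuous_re
  have hDc : IsPreconnected D := (convex_halfSpace_re_gt _).isPreconnected
  have han : AnalyticOnNhd ℂ (fun z => integralI n z ξ) D :=
    DifferentiableOn.analyticOnNhd
      (fun z hz => (differentiableAt_integralI hz h0 h1).differentiableWithinAt) hDo
  set L : ℝ → ℂ := fun y => (ρ : ℂ) + y * Complex.I with hL
  have hLD : ∀ y, L y ∈ D := fun y => by simpa [hL, hD] using hρ
  have hLan : AnalyticOnNhd ℝ L univ := fun y _ => by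
    refine analyticAt_const.add (AnalyticAt.mul ?_ analyticAt_const)
    exact Complex.ofRealCLM.analyticAt y
  have hcomp : AnalyticOnNhd ℝ (fun y => integralI n (L y) ξ) univ := fun y _ =>
    ((han (L y) (hLD y)).restrictScalars (𝕜 := ℝ)).comp (hLan y (mem_univ y))
  -- Vanishing on the whole line would spread to the half-plane by the identity theorem, against
  -- `exists_integralI_ne_zero`. Otherwise the zeros have codiscrete complement, hence measure zero.
  rcases hcomp.eqOn_zero_or_eventually_ne_zero_of_preconnected isPreconnected_univ with h | h
  · exfalso
    obtain ⟨z, hz, hne⟩ := exists_integralI_ne_zero n h0 h1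
    refine hne (han.eqOn_zero_of_preconnected_of_frequently_eq_zero hDc (hLD 0) ?_
      (show (z : ℂ) ∈ D by simpa [hD] using hz))
    have hLt : Tendsto L (𝓝[≠] 0) (𝓝[≠] (L 0)) := by
      refine tendsto_nhdsWithin_of_tendsto_nhds_of_eventually_within _ ?_ ?_
      · exact ((by fun_prop : Continuous L).tendsto 0).mono_left nhdsWithin_le_nhds
      · filter_upwards [self_mem_nhdsWithin] with y hy
        simpa [hL] using hy
    exact hLt.frequently (Frequently.of_forall fun y => h (mem_univ y))
  · have := ae_restrict_le_codiscreteWithin (μ := volume) MeasurableSet.univ h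
    rw [Measure.restrict_univ] at this
    exact this

/-! ### Azimuthal Fourier coefficients of the function and of the line data. -/

theorem fourierCoeffOn_neg_pi_pi (g : ℝ → ℂ) (n : ℤ) :
    fourierCoeffOn neg_pi_lt_pi g n = (1 / (2 * Real.pi) : ℂ) *
      ∫ φ in (-Real.pi)..Real.pi, Complex.exp (-(n * φ * Complex.I)) * g φ := by
  rw [fourierCoeffOn_eq_integral, Complex.real_smul]
  congr 1
  · push_cast; ring
  · refine intervalIntegral.integral_congr fun φ _ => ?_
    simp only [smul_eq_mul]
    rw [fourier_coe_apply]
    congr 2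
    have : (Real.pi : ℂ) ≠ 0 := Complex.ofReal_ne_zero.2 Real.pi_ne_zero
    push_cast
    field_simp
    ring

theorem norm_cyl_sq (r φ τ : ℝ) :
    ‖(!₂[r * Real.cos φ, r * Real.sin φ, τ] : E3)‖ ^ 2 = r ^ 2 + τ ^ 2 := by
  rw [EuclideanSpace.norm_sq_eq]
  simp only [Fin.sum_univ_three, Matrix.cons_val_zero, Matrix.cons_val_one,
    Matrix.cons_val, Real.norm_eq_abs, sq_abs]
  linear_combination r ^ 2 * Real.sin_sq_add_cos_sq φ

theorem norm_linePoint_sq (lam θ φ t : ℝ) : ‖linePoint lam θ φ t‖ ^ 2 = lam ^ 2 + t ^ 2 := by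
  rw [EuclideanSpace.norm_sq_eq]
  simp only [linePoint, Fin.sum_univ_three, PiLp.toLp_apply, Matrix.cons_val_zero,
    Matrix.cons_val_one, Matrix.cons_val, Real.norm_eq_abs, sq_abs]
  linear_combination (lam ^ 2 + t ^ 2 * Real.cos θ ^ 2) * Real.sin_sq_add_cos_sq φ +
    t ^ 2 * Real.sin_sq_add_cos_sq θ

theorem continuous_linePoint (lam θ : ℝ) :
    Continuous fun p : ℝ × ℝ => linePoint lam θ p.1 p.2 := by
  refine (PiLp.continuous_toLp 2 _).comp (continuous_pi fun i => ?_)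
  fin_cases i <;> simp <;> fun_prop

theorem continuous_cyl :
    Continuous fun p : (ℝ × ℝ) × ℝ => (!₂[p.1.1 * Real.cos p.2, p.1.1 * Real.sin p.2, p.1.2] : E3) := by
  refine (PiLp.continuous_toLp 2 _).comp (continuous_pi fun i => ?_)
  fin_cases i <;> simp <;> fun_prop

/-- `f` is bounded by `C` and vanishes outside the part of the ball of radius `R` at height at
least `a`. -/
structure SupportBounds (f : E3 → ℂ) (a R C : ℝ) : Prop where
  pos : 0 < a
  norm_le : ∀ x, ‖f x‖ ≤ C
  height : ∀ x, f x ≠ 0 → a ≤ x 2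
  ball : ∀ x, f x ≠ 0 → ‖x‖ ≤ R

theorem exists_supportBounds {f : E3 → ℂ} (hf : Continuous f) (hfc : HasCompactSupport f)
    (hfs : tsupport f ⊆ {x | 0 < x 2}) : ∃ a R C, SupportBounds f a R C := by
  obtain ⟨C, hC⟩ := hfc.exists_bound_of_continuous hf
  obtain ⟨R, hR⟩ := hfc.isCompact.isBounded.exists_norm_le
  have hc : Continuous fun x : E3 => x 2 := by fun_prop
  obtain ⟨a, ha, hK⟩ := hfc.isCompact.exists_forall_le' hc.continuousOn (a := (0 : ℝ))
    (fun x hx => hfs hx)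
  exact ⟨a, R, C, ha, hC, fun x hx => hK x (subset_tsupport f hx),
    fun x hx => hR x (subset_tsupport f hx)⟩

theorem fCoeff_eq (f : E3 → ℂ) (n : ℤ) (r τ : ℝ) :
    fCoeff f n r τ = (1 / (2 * Real.pi) : ℂ) * ∫ φ in (-Real.pi)..Real.pi,
      Complex.exp (-(n * φ * Complex.I)) * f !₂[r * Real.cos φ, r * Real.sin φ, τ] :=
  fourierCoeffOn_neg_pi_pi _ _

theorem continuous_fCoeff {f : E3 → ℂ} (hf : Continuous f) (n : ℤ) :
    Continuous fun p : ℝ × ℝ => fCoeff f n p.1 p.2 := by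
  simp only [fCoeff_eq]
  refine continuous_const.mul
    (intervalIntegral.continuous_parametric_intervalIntegral_of_continuous' ?_ _ _)
  have := hf.comp continuous_cyl
  exact Continuous.mul (by fun_prop) this

theorem norm_exp_neg_int_mul_I (n : ℤ) (φ : ℝ) : ‖Complex.exp (-(n * φ * Complex.I))‖ = 1 := by
  rw [Complex.norm_exp]; simp

namespace SupportBounds

variable {f : E3 → ℂ} {a R C : ℝ}

theorem norm_fCoeff_le (h : SupportBounds f a R C) (n : ℤ) (r τ : ℝ) : ‖fCoeff f n r τ‖ ≤ C := by
  have h1 : ‖∫ φ in (-Real.pi)..Real.pi,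
      Complex.exp (-(n * φ * Complex.I)) * f !₂[r * Real.cos φ, r * Real.sin φ, τ]‖ ≤
      C * |Real.pi - -Real.pi| :=
    intervalIntegral.norm_integral_le_of_norm_le_const fun φ _ => by
      rw [norm_mul, norm_exp_neg_int_mul_I, one_mul]; exact h.norm_le _
  have hπ := Real.pi_pos
  have h2 : |Real.pi - -Real.pi| = 2 * Real.pi := by rw [abs_of_pos] <;> linarith
  have h3 : ‖(1 / (2 * Real.pi) : ℂ)‖ = 1 / (2 * Real.pi) := by
    simp [abs_of_pos hπ]
  rw [fCoeff_eq, norm_mul, h3]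
  rw [h2] at h1
  calc 1 / (2 * Real.pi) * _ ≤ 1 / (2 * Real.pi) * (C * (2 * Real.pi)) := by gcongr
    _ = C := by field_simp

theorem fCoeff_eq_zero_of_height (h : SupportBounds f a R C) (n : ℤ) {r τ : ℝ} (hτ : τ < a) :
    fCoeff f n r τ = 0 := by
  have : ∀ φ : ℝ, f !₂[r * Real.cos φ, r * Real.sin φ, τ] = 0 := fun φ => by
    by_contra hne
    exact absurd (h.height _ hne) (by simpa using hτ)
  simp [fCoeff_eq, this]

theorem fCoeff_eq_zero_of_radius (h : SupportBounds f a R C) (n : ℤ) {r τ : ℝ}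
    (hr : R ^ 2 < r ^ 2 + τ ^ 2) : fCoeff f n r τ = 0 := by
  have : ∀ φ : ℝ, f !₂[r * Real.cos φ, r * Real.sin φ, τ] = 0 := fun φ => by
    by_contra hne
    have h1 := h.ball _ hne
    have h2 := norm_cyl_sq r φ τ
    nlinarith [norm_nonneg (!₂[r * Real.cos φ, r * Real.sin φ, τ] : E3)]
  simp [fCoeff_eq, this]

/-- Confinement to a box with `τ` bounded away from `0` makes the height Mellin integrals converge
for every `ξ`, uniformly in `r`. -/
theorem norm_fCoeff_le_indicator (h : SupportBounds f a R C) (n : ℤ) (r τ : ℝ) :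
    ‖fCoeff f n r τ‖ ≤ (Icc (-|R|) |R|).indicator (fun _ => 1) r * (Icc a |R|).indicator (fun _ => C) τ := by
  by_cases h1 : τ < a
  · rw [h.fCoeff_eq_zero_of_height n h1, indicator_of_notMem (fun h' => absurd h'.1 (not_le.2 h1))
      (fun _ => C)]
    simp
  by_cases h2 : R ^ 2 < r ^ 2 + τ ^ 2
  · rw [h.fCoeff_eq_zero_of_radius n h2, norm_zero]
    have : 0 ≤ C := (norm_nonneg _).trans (h.norm_le 0)
    exact mul_nonneg (indicator_nonneg (fun _ _ => zero_le_one) _)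
      (indicator_nonneg (fun _ _ => this) _)
  · push Not at h1 h2
    have hr : |r| ≤ |R| := sq_le_sq.1 (by nlinarith [sq_nonneg τ])
    have hτ : |τ| ≤ |R| := sq_le_sq.1 (by nlinarith [sq_nonneg r])
    rw [indicator_of_mem (show r ∈ Icc (-|R|) |R| from abs_le.1 hr),
      indicator_of_mem (show τ ∈ Icc a |R| from ⟨h1, (le_abs_self τ).trans hτ⟩), one_mul]
    exact h.norm_fCoeff_le n r τ

end SupportBounds

/-- The point of the line `l_{lam, θ, φ}` with parameter `t` has the azimuth `φ + α`, so its
contribution to the Fourier coefficient is that of `f`, up to a phase. -/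
theorem integral_exp_mul_linePoint (f : E3 → ℂ) (n : ℤ) {lam θ t r α : ℝ}
    (h1 : lam = r * Real.cos α) (h2 : t * Real.cos θ = r * Real.sin α) :
    (1 / (2 * Real.pi) : ℂ) * ∫ φ in (-Real.pi)..Real.pi,
      Complex.exp (-(n * φ * Complex.I)) * f (linePoint lam θ φ t) =
    Complex.exp (n * α * Complex.I) * fCoeff f n r (t * Real.sin θ) := by
  set q : ℝ → ℂ := fun ψ => Complex.exp (-(n * ψ * Complex.I)) *
    f !₂[r * Real.cos ψ, r * Real.sin ψ, t * Real.sin θ] with hq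
  have hper : Function.Periodic q (2 * Real.pi) := fun ψ => by
    simp only [hq, Real.cos_add_two_pi, Real.sin_add_two_pi]
    congr 1
    rw [Complex.exp_eq_exp_iff_exists_int]
    exact ⟨-n, by push_cast; ring⟩
  have e : ∀ φ : ℝ, Complex.exp (-(n * φ * Complex.I)) * f (linePoint lam θ φ t) =
      Complex.exp (n * α * Complex.I) * q (φ + α) := fun φ => by
    have hp : linePoint lam θ φ t =
        !₂[r * Real.cos (φ + α), r * Real.sin (φ + α), t * Real.sin θ] := by
      rw [linePoint, h2, h1, Real.cos_add, Real.sin_add]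
      congr 2
      · ring
      · congr 1; ring
    simp only [hq]
    rw [hp, ← mul_assoc, ← Complex.exp_add]
    congr 2
    push_cast
    ring
  simp only [e]
  rw [intervalIntegral.integral_const_mul, intervalIntegral.integral_comp_add_right, fCoeff_eq,
    mul_left_comm]
  congr 2
  -- By periodicity the shift of azimuth by `α` does not change the integral over a period.
  have h3 := hper.intervalIntegral_add_eq (-Real.pi + α) (-Real.pi)
  have e1 : -Real.pi + α + 2 * Real.pi = Real.pi + α := by ring
  have e2 : -Real.pi + 2 * Real.pi = Real.pi := by ring
  rwa [e1, e2] at h3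

theorem SupportBounds.GCoeff_eq {f : E3 → ℂ} {a R C : ℝ} (h : SupportBounds f a R C)
    (hf : Continuous f) (n : ℤ) (lam θ : ℝ) :
    GCoeff f n lam θ = ∫ t : ℝ, (1 / (2 * Real.pi) : ℂ) * ∫ φ in (-Real.pi)..Real.pi,
      Complex.exp (-(n * φ * Complex.I)) * f (linePoint lam θ φ t) := by
  rw [GCoeff, fourierCoeffOn_neg_pi_pi, integral_const_mul]
  congr 1
  simp only [lineData, ← integral_const_mul]
  refine intervalIntegral_integral_swap ?_
  have hcont : Continuous (Function.uncurry fun φ t : ℝ =>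
      Complex.exp (-(n * φ * Complex.I)) * f (linePoint lam θ φ t)) :=
    Continuous.mul (by fun_prop) (hf.comp (continuous_linePoint lam θ))
  have hb : Integrable (fun p : ℝ × ℝ => (1 : ℝ) * (Icc (-|R|) |R|).indicator (fun _ => C) p.2)
      ((volume.restrict (uIoc (-Real.pi) Real.pi)).prod volume) := by
    refine Integrable.mul_prod (f := fun _ : ℝ => (1 : ℝ))
      (g := (Icc (-|R|) |R|).indicator fun _ => C) ?_ ?_
    · exact integrableOn_const (by simp [uIoc])
    · exact (integrable_indicator_iff measurableSet_Icc).2 (integrableOn_const (by simp))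
  refine hb.mono' hcont.aestronglyMeasurable (Eventually.of_forall fun p => ?_)
  simp only [Function.uncurry]
  rw [norm_mul, norm_exp_neg_int_mul_I, one_mul, one_mul]
  by_cases h0 : f (linePoint lam θ p.1 p.2) = 0
  · rw [h0, norm_zero]
    exact indicator_nonneg (fun _ _ => (norm_nonneg _).trans (h.norm_le 0)) _
  · have h1 := h.ball _ h0
    have h2 := norm_linePoint_sq lam θ p.1 p.2
    have h3 : |p.2| ≤ |R| := sq_le_sq.1 (by
      nlinarith [norm_nonneg (linePoint lam θ p.1 p.2), sq_nonneg lam])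
    rw [indicator_of_mem (show p.2 ∈ Icc (-|R|) |R| from abs_le.1 h3)]
    exact h.norm_le _

/-- The `n`-th power of the phase of `lam + iu`. -/
noncomputable def phase (n : ℤ) (lam u : ℝ) : ℂ :=
  (((lam : ℂ) + u * Complex.I) / (√(lam ^ 2 + u ^ 2) : ℝ)) ^ n

theorem phase_eq_exp (n : ℤ) (lam : ℝ) {u : ℝ} (hu : 0 < u) :
    phase n lam u = Complex.exp (n * ((lam : ℂ) + u * Complex.I).arg * Complex.I) := by
  set z : ℂ := (lam : ℂ) + u * Complex.I with hz
  have hn : ‖z‖ = √(lam ^ 2 + u ^ 2) := Complex.norm_add_mul_I lam u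
  have hn0 : (‖z‖ : ℂ) ≠ 0 := by
    rw [hn]; exact Complex.ofReal_ne_zero.2 (by positivity)
  rw [phase, ← hz, ← hn, mul_assoc, Complex.exp_int_mul]
  congr 1
  rw [div_eq_iff hn0, mul_comm, Complex.norm_mul_exp_arg_mul_I]

/-- The variable is `u = t cos θ`; its Jacobian `√(1+s²)` is cancelled by the normalization of
`GStar`. Parameters `t ≤ 0` give points of height at most `0`, where `f` vanishes. -/
theorem SupportBounds.GStar_eq {f : E3 → ℂ} {a R C : ℝ} (h : SupportBounds f a R C)
    (hf : Continuous f) (n : ℤ) (lam : ℝ) {s : ℝ} (hs : 0 < s) :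
    GStar f n lam s = ∫ u in Ioi (0 : ℝ),
      phase n lam u * fCoeff f n (√(lam ^ 2 + u ^ 2)) (u * s) := by
  set θ := Real.arctan s with hθ
  have hcos : Real.cos θ = 1 / √(1 + s ^ 2) := Real.cos_arctan s
  have hsin : Real.sin θ = Real.cos θ * s := by
    rw [hcos, hθ, Real.sin_arctan]; ring
  have hw : 0 < √(1 + s ^ 2) := by positivity
  have hc : 0 < Real.cos θ := by rw [hcos]; positivity
  have hval : ∀ t ∈ Ioi (0 : ℝ), (1 / (2 * Real.pi) : ℂ) * ∫ φ in (-Real.pi)..Real.pi,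
      Complex.exp (-(n * φ * Complex.I)) * f (linePoint lam θ φ t) =
      (fun u => phase n lam u * fCoeff f n (√(lam ^ 2 + u ^ 2)) (u * s)) (Real.cos θ * t) := by
    intro t ht
    have ht0 : 0 < t := ht
    set u := Real.cos θ * t with hu
    have hu0 : 0 < u := by positivity
    have hn : ‖(lam : ℂ) + u * Complex.I‖ = √(lam ^ 2 + u ^ 2) := Complex.norm_add_mul_I lam u
    rw [integral_exp_mul_linePoint f n (r := √(lam ^ 2 + u ^ 2))
      (α := ((lam : ℂ) + u * Complex.I).arg), ← phase_eq_exp n lam hu0]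
    · simp only
      rw [hsin, hu]
      ring_nf
    · rw [← hn, Complex.norm_mul_cos_arg]; simp
    · rw [← hn, Complex.norm_mul_sin_arg, mul_comm, ← hu]; simp
  have hsub := integral_comp_mul_left_Ioi
    (fun u => phase n lam u * fCoeff f n (√(lam ^ 2 + u ^ 2)) (u * s)) 0 hc
  rw [GStar, h.GCoeff_eq hf, ← hθ, ← setIntegral_eq_integral_of_forall_compl_eq_zero (s := Ioi 0),
    setIntegral_congr_fun measurableSet_Ioi hval, hsub, mul_zero,
    Complex.real_smul, hcos]
  · have : ((√(1 + s ^ 2) : ℝ) : ℂ) ≠ 0 := Complex.ofReal_ne_zero.2 hw.ne'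
    push_cast
    field_simp
  · intro t ht
    have : ∀ φ : ℝ, f (linePoint lam θ φ t) = 0 := fun φ => by
      by_contra hne
      have h1 := h.height _ hne
      have h2 : (linePoint lam θ φ t) 2 = t * Real.sin θ := by simp [linePoint]
      rw [h2, hsin] at h1
      have h3 : t ≤ 0 := not_lt.1 ht
      have h4 : 0 < Real.cos θ * s := by positivity
      nlinarith [h.pos]
    simp [this]

/-! ### The two Mellin transforms of the data and the factorization. -/

/-- The Mellin transform of `f_n(r, ·)`. -/
noncomputable def heightMellin (f : E3 → ℂ) (n : ℤ) (ξ : ℂ) (r : ℝ) : ℂ :=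
  mellin (fun τ => fCoeff f n r τ) ξ

/-- The Mellin transform of `r^{-n} f_n(r, ·)`. -/
noncomputable def reducedMellin (f : E3 → ℂ) (n : ℤ) (ξ : ℂ) (r : ℝ) : ℂ :=
  (r : ℂ) ^ (-n) * heightMellin f n ξ r

/-- The weight in the superposition of dilates that gives `GStarStar`. -/
noncomputable def weight (n : ℤ) (ξ : ℂ) (t : ℝ) : ℂ :=
  (t : ℂ) ^ (-ξ) * (1 + Complex.I * (t : ℂ)) ^ n

theorem integrableOn_rpow_mul_indicator {a : ℝ} (ha : 0 < a) (b C σ : ℝ) :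
    IntegrableOn (fun x : ℝ => x ^ (σ - 1) * (Icc a b).indicator (fun _ => C) x) (Ioi 0) := by
  have h1 : IntegrableOn (fun x : ℝ => x ^ (σ - 1) * C) (Icc a b) := by
    refine ContinuousOn.integrableOn_Icc (ContinuousOn.mul ?_ continuousOn_const)
    exact ContinuousOn.rpow_const (by fun_prop) fun x hx => Or.inl (ha.trans_le hx.1).ne'
  have h2 := ((integrable_indicator_iff measurableSet_Icc).2 h1).integrableOn (s := Ioi 0)
  refine h2.congr_fun (fun x _ => ?_) measurableSet_Ioi
  by_cases hx : x ∈ Icc a b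
  · simp only [indicator_of_mem hx]
  · simp only [indicator_of_notMem hx, mul_zero]

theorem continuousOn_phase (n : ℤ) (lam : ℝ) : ContinuousOn (phase n lam) (Ioi 0) := by
  have h : ∀ u ∈ Ioi (0 : ℝ), ((√(lam ^ 2 + u ^ 2) : ℝ) : ℂ) ≠ 0 := fun u hu => by
    have : 0 < u := hu
    exact Complex.ofReal_ne_zero.2 (by positivity)
  refine ContinuousOn.zpow₀ (ContinuousOn.div (by fun_prop) (by fun_prop) h) n fun u hu => ?_
  refine Or.inl (div_ne_zero (fun h0 => ?_) (h u hu))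
  have := congrArg Complex.im h0
  simp at this
  exact (ne_of_gt hu) this

theorem norm_phase (n : ℤ) (lam : ℝ) {u : ℝ} (hu : 0 < u) : ‖phase n lam u‖ = 1 := by
  rw [phase_eq_exp n lam hu, Complex.norm_exp]; simp

namespace SupportBounds

variable {f : E3 → ℂ} {a R C : ℝ}

theorem norm_rpow_mul_fCoeff_le (h : SupportBounds f a R C) (n : ℤ) (σ r : ℝ) {x : ℝ} (hx : 0 < x) :
    x ^ (σ - 1) * ‖fCoeff f n r x‖ ≤ (Icc (-|R|) |R|).indicator (fun _ => (1 : ℝ)) r *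
      (x ^ (σ - 1) * (Icc a |R|).indicator (fun _ => C) x) := by
  rw [mul_left_comm]
  exact mul_le_mul_of_nonneg_left (h.norm_fCoeff_le_indicator n r x) (by positivity)

theorem norm_cpow_smul_fCoeff_le (h : SupportBounds f a R C) (n : ℤ) (ξ : ℂ) (r : ℝ) {x : ℝ}
    (hx : 0 < x) : ‖(x : ℂ) ^ (ξ - 1) • fCoeff f n r x‖ ≤
      (Icc (-|R|) |R|).indicator (fun _ => (1 : ℝ)) r *
      (x ^ (ξ.re - 1) * (Icc a |R|).indicator (fun _ => C) x) := by
  rw [norm_smul, Complex.norm_cpow_eq_rpow_re_of_pos hx]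
  exact h.norm_rpow_mul_fCoeff_le n ξ.re r hx

theorem integral_rpow_mul_norm_fCoeff_le (h : SupportBounds f a R C) (n : ℤ) (σ r : ℝ) :
    ∫ x in Ioi (0 : ℝ), x ^ (σ - 1) * ‖fCoeff f n r x‖ ≤
      (Icc (-|R|) |R|).indicator (fun _ => (1 : ℝ)) r *
        ∫ x in Ioi (0 : ℝ), x ^ (σ - 1) * (Icc a |R|).indicator (fun _ => C) x := by
  rw [← integral_const_mul]
  refine integral_mono_of_nonneg ?_
    ((integrableOn_rpow_mul_indicator h.pos |R| C σ).const_mul _) ?_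
  · filter_upwards [ae_restrict_mem measurableSet_Ioi] with x (hx : 0 < x)
    simp only [Pi.zero_apply]
    positivity
  · filter_upwards [ae_restrict_mem measurableSet_Ioi] with x (hx : 0 < x)
    exact h.norm_rpow_mul_fCoeff_le n σ r hx

theorem norm_heightMellin_le (h : SupportBounds f a R C) (n : ℤ) (ξ : ℂ) (r : ℝ) :
    ‖heightMellin f n ξ r‖ ≤ (Icc (-|R|) |R|).indicator (fun _ => (1 : ℝ)) r *
        ∫ x in Ioi (0 : ℝ), x ^ (ξ.re - 1) * (Icc a |R|).indicator (fun _ => C) x := by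
  rw [heightMellin, mellin, ← integral_const_mul]
  refine norm_integral_le_of_norm_le
    ((integrableOn_rpow_mul_indicator h.pos |R| C ξ.re).const_mul _) ?_
  filter_upwards [ae_restrict_mem measurableSet_Ioi] with x (hx : 0 < x)
  exact h.norm_cpow_smul_fCoeff_le n ξ r hx

theorem aestronglyMeasurable_cpow_smul_fCoeff (hf : Continuous f) (n : ℤ) (ξ : ℂ) (r : ℝ) :
    AEStronglyMeasurable (fun x : ℝ => (x : ℂ) ^ (ξ - 1) • fCoeff f n r x)
      (volume.restrict (Ioi 0)) := by
  refine ContinuousOn.aestronglyMeasurable (ContinuousOn.fun_smul ?_ ?_) measurableSet_Ioi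
  · exact ContinuousOn.cpow_const (by fun_prop) fun t ht => Complex.ofReal_mem_slitPlane.2 ht
  · exact ((continuous_fCoeff hf n).comp (by fun_prop : Continuous fun x : ℝ => (r, x))).continuousOn

theorem mellinConvergent_fCoeff (h : SupportBounds f a R C) (hf : Continuous f) (n : ℤ) (ξ : ℂ)
    (r : ℝ) : MellinConvergent (fun τ => fCoeff f n r τ) ξ := by
  refine Integrable.mono' ((integrableOn_rpow_mul_indicator h.pos |R| C ξ.re).const_mul
    ((Icc (-|R|) |R|).indicator (fun _ => (1 : ℝ)) r))
    (aestronglyMeasurable_cpow_smul_fCoeff hf n ξ r) ?_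
  filter_upwards [ae_restrict_mem measurableSet_Ioi] with x (hx : 0 < x)
  exact h.norm_cpow_smul_fCoeff_le n ξ r hx

theorem continuous_heightMellin (h : SupportBounds f a R C) (hf : Continuous f) (n : ℤ) (ξ : ℂ) :
    Continuous (heightMellin f n ξ) := by
  refine continuous_of_dominated (fun r => aestronglyMeasurable_cpow_smul_fCoeff hf n ξ r)
    (bound := fun x => x ^ (ξ.re - 1) * (Icc a |R|).indicator (fun _ => C) x) ?_
    (integrableOn_rpow_mul_indicator h.pos |R| C ξ.re) ?_
  · intro r
    filter_upwards [ae_restrict_mem measurableSet_Ioi] with x (hx : 0 < x)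
    refine (h.norm_cpow_smul_fCoeff_le n ξ r hx).trans (mul_le_of_le_one_left ?_ ?_)
    · have : 0 ≤ C := (norm_nonneg _).trans (h.norm_le 0)
      exact mul_nonneg (by positivity) (indicator_nonneg (fun _ _ => this) _)
    · exact indicator_le_self' (fun _ _ => zero_le_one) r
  · refine Eventually.of_forall fun x => Continuous.fun_const_smul ?_ _
    exact (continuous_fCoeff hf n).comp (by fun_prop : Continuous fun r : ℝ => (r, x))

theorem mellin_GStar (h : SupportBounds f a R C) (hf : Continuous f) (n : ℤ) (lam : ℝ) {ξ : ℂ}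
    (hξ : ξ.re < 1) :
    MellinConvergent (fun s => GStar f n lam s) ξ ∧
    mellin (fun s => GStar f n lam s) ξ = ∫ u in Ioi (0 : ℝ),
      phase n lam u * (u : ℂ) ^ (-ξ) * heightMellin f n ξ (√(lam ^ 2 + u ^ 2)) := by
  set M := ∫ x in Ioi (0 : ℝ), x ^ (ξ.re - 1) * (Icc a |R|).indicator (fun _ => C) x with hM
  have hC : 0 ≤ C := (norm_nonneg _).trans (h.norm_le 0)
  have hM0 : 0 ≤ M := setIntegral_nonneg measurableSet_Ioi fun x hx => by
    have : 0 < x := hx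
    exact mul_nonneg (by positivity) (indicator_nonneg (fun _ _ => hC) _)
  -- For `u > |R|` the radius `√(lam² + u²)` exceeds `|R|`, so the majorant may be cut off there;
  -- near `0` it is integrable because `ξ.re < 1`.
  have key := mellin_integral_mul_comp_mul (s := ξ) (w := phase n lam) (c := fun u => u)
    (k := fun u s => fCoeff f n (√(lam ^ 2 + u ^ 2)) s)
    (g := (Ioc 0 |R|).indicator fun u => u ^ (-ξ.re) * M) ?_ (fun t ht => ht)
    (fun t _ => h.mellinConvergent_fCoeff hf n ξ _) ?_ ?_
  · have e : EqOn (fun s => GStar f n lam s)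
        (fun x => ∫ t in Ioi (0 : ℝ), phase n lam t * fCoeff f n (√(lam ^ 2 + t ^ 2)) (t * x))
        (Ioi 0) := fun s hs => h.GStar_eq hf n lam hs
    constructor
    · refine key.1.congr_fun (fun s hs => ?_) measurableSet_Ioi
      simp only [e hs]
    · refine Eq.trans ?_ key.2
      refine setIntegral_congr_fun measurableSet_Ioi fun s hs => ?_
      simp only [e hs]
  · rw [Measure.prod_restrict]
    refine ContinuousOn.aestronglyMeasurable (ContinuousOn.mul ?_ (ContinuousOn.mul ?_ ?_))
      (measurableSet_Ioi.prod measurableSet_Ioi)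
    · exact ContinuousOn.cpow_const (by fun_prop) fun p hp => Complex.ofReal_mem_slitPlane.2 hp.2
    · exact (continuousOn_phase n lam).comp continuousOn_fst fun p hp => hp.1
    · exact ((continuous_fCoeff hf n).comp
        (by fun_prop : Continuous fun p : ℝ × ℝ => (√(lam ^ 2 + p.1 ^ 2), p.1 * p.2))).continuousOn
  · refine ((integrable_indicator_iff measurableSet_Ioc).2 ?_).integrableOn
    refine Integrable.mul_const ?_ M
    exact (intervalIntegrable_iff_integrableOn_Ioc_of_le (abs_nonneg R)).1
        (intervalIntegral.intervalIntegrable_rpow' (by linarith))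
  · intro t ht
    rw [norm_phase n lam ht, one_mul]
    have h1 := h.integral_rpow_mul_norm_fCoeff_le n ξ.re (√(lam ^ 2 + t ^ 2))
    by_cases hr : t ≤ |R|
    · rw [indicator_of_mem (show t ∈ Ioc 0 |R| from ⟨ht, hr⟩)]
      gcongr
      refine h1.trans (mul_le_of_le_one_left hM0 ?_)
      exact indicator_le_self' (fun _ _ => zero_le_one) _
    · have h2 : √(lam ^ 2 + t ^ 2) ∉ Icc (-|R|) |R| := fun h3 => hr <| by
        refine le_trans (Real.le_sqrt_of_sq_le ?_) h3.2
        nlinarith [sq_nonneg lam]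
      rw [indicator_of_notMem h2, zero_mul] at h1
      rw [indicator_of_notMem (fun h3 => hr h3.2)]
      exact mul_nonpos_of_nonneg_of_nonpos (by positivity) h1

theorem continuousOn_reducedMellin (h : SupportBounds f a R C) (hf : Continuous f) (n : ℤ)
    (ξ : ℂ) : ContinuousOn (reducedMellin f n ξ) (Ioi 0) := by
  refine ContinuousOn.mul ?_ (h.continuous_heightMellin hf n ξ).continuousOn
  exact ContinuousOn.zpow₀ (by fun_prop) _ fun r hr => Or.inl (Complex.ofReal_ne_zero.2 (ne_of_gt hr))

/-- The factor `r^{-n}` puts `r^{ζ-1-n}` at the origin, whence the bound on `ζ.re`; large radii do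
not contribute. -/
theorem mellinConvergent_reducedMellin (h : SupportBounds f a R C) (hf : Continuous f) (n : ℤ)
    {ζ : ℂ} (hζ : (n : ℝ) < ζ.re) (ξ : ℂ) : MellinConvergent (reducedMellin f n ξ) ζ := by
  set M := ∫ x in Ioi (0 : ℝ), x ^ (ξ.re - 1) * (Icc a |R|).indicator (fun _ => C) x with hM
  have hdom : IntegrableOn ((Ioc 0 |R|).indicator fun r => r ^ (ζ.re - 1 - n) * M) (Ioi 0) := by
    refine ((integrable_indicator_iff measurableSet_Ioc).2 ?_).integrableOn
    refine Integrable.mul_const ?_ M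
    exact (intervalIntegrable_iff_integrableOn_Ioc_of_le (abs_nonneg R)).1
        (intervalIntegral.intervalIntegrable_rpow' (by linarith))
  refine Integrable.mono' hdom ?_ ?_
  · refine ContinuousOn.aestronglyMeasurable (ContinuousOn.fun_smul ?_
      (h.continuousOn_reducedMellin hf n ξ)) measurableSet_Ioi
    exact ContinuousOn.cpow_const (by fun_prop) fun t ht => Complex.ofReal_mem_slitPlane.2 ht
  · filter_upwards [ae_restrict_mem measurableSet_Ioi] with r (hr : 0 < r)
    have h1 := h.norm_heightMellin_le n ξ r
    have h2 : ‖(r : ℂ) ^ (ζ - 1) • reducedMellin f n ξ r‖ =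
        r ^ (ζ.re - 1 - n) * ‖heightMellin f n ξ r‖ := by
      rw [reducedMellin, norm_smul, norm_mul, norm_zpow, Complex.norm_cpow_eq_rpow_re_of_pos hr,
        Complex.norm_real, Real.norm_of_nonneg hr.le, ← Real.rpow_intCast, ← mul_assoc,
        ← Real.rpow_add hr]
      simp [sub_eq_add_neg]
    rw [h2]
    by_cases hR : r ≤ |R|
    · rw [indicator_of_mem (show r ∈ Ioc 0 |R| from ⟨hr, hR⟩)]
      rw [indicator_of_mem (show r ∈ Icc (-|R|) |R| from ⟨by linarith, hR⟩), one_mul] at h1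
      gcongr
    · rw [indicator_of_notMem (fun h' => hR h'.2), zero_mul] at h1
      rw [indicator_of_notMem (fun h' => hR h'.2)]
      exact mul_nonpos_of_nonneg_of_nonpos (by positivity) h1

/-- Substituting `u = lam t` produces `lam` from the Jacobian and `lam^{-ξ}` from the power. With
the factor `lam^{ξ-n-1}` they give `lam^{-n}`, which joins `(1+t²)^{-n/2}` from the phase to form
the `-n`-th power of the radius. -/
theorem GStarStar_eq (h : SupportBounds f a R C) (hf : Continuous f) (n : ℤ) {lam : ℝ}
    (hlam : 0 < lam) {ξ : ℂ} (hξ : ξ.re < 1) :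
    GStarStar f n lam ξ = ∫ t in Ioi (0 : ℝ),
      weight n ξ t * reducedMellin f n ξ (√(1 + t ^ 2) * lam) := by
  have hl0 : (lam : ℂ) ≠ 0 := Complex.ofReal_ne_zero.2 hlam.ne'
  have hsub := integral_comp_mul_left_Ioi (fun u : ℝ =>
    phase n lam u * (u : ℂ) ^ (-ξ) * heightMellin f n ξ (√(lam ^ 2 + u ^ 2))) 0 hlam
  rw [mul_zero, Complex.real_smul, eq_comm, Complex.ofReal_inv, inv_mul_eq_iff_eq_mul₀ hl0] at hsub
  rw [GStarStar, (h.mellin_GStar hf n lam hξ).2, hsub, ← mul_assoc, ← integral_const_mul]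
  refine setIntegral_congr_fun measurableSet_Ioi fun t ht => ?_
  have ht0 : 0 < t := ht
  set c := √(1 + t ^ 2) with hc
  have hc0 : 0 < c := by positivity
  have hcC : (c : ℂ) ≠ 0 := Complex.ofReal_ne_zero.2 hc0.ne'
  have e1 : √(lam ^ 2 + (lam * t) ^ 2) = c * lam := by
    rw [show lam ^ 2 + (lam * t) ^ 2 = (1 + t ^ 2) * lam ^ 2 by ring,
      Real.sqrt_mul (by positivity), Real.sqrt_sq hlam.le]
  have e2 : phase n lam (lam * t) = (1 + Complex.I * (t : ℂ)) ^ n * (c : ℂ) ^ (-n) := by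
    rw [phase, e1, zpow_neg, ← div_eq_mul_inv, ← div_zpow]
    congr 1
    push_cast
    field_simp
  have e3 : ((lam * t : ℝ) : ℂ) ^ (-ξ) = (lam : ℂ) ^ (-ξ) * (t : ℂ) ^ (-ξ) := by
    rw [Complex.ofReal_mul, Complex.mul_cpow_ofReal_nonneg hlam.le ht0.le]
  have e4 : (lam : ℂ) ^ (ξ - n - 1) * lam * (lam : ℂ) ^ (-ξ) = (lam : ℂ) ^ (-n) := by
    nth_rewrite 2 [← Complex.cpow_one (lam : ℂ)]
    rw [← Complex.cpow_add _ _ hl0, ← Complex.cpow_add _ _ hl0, ← Complex.cpow_intCast]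
    congr 1; push_cast; ring
  rw [e1, e2, e3, weight, reducedMellin, Complex.ofReal_mul, mul_zpow, ← e4]
  ring

theorem kernelI_eq_weight (n : ℤ) (ζ ξ : ℂ) (t : ℝ) :
    kernelI n ζ ξ t = weight n ξ t * ((√(1 + t ^ 2) : ℝ) : ℂ) ^ (-ζ) := by
  have h : 0 < 1 + t ^ 2 := by positivity
  have : ((√(1 + t ^ 2) : ℝ) : ℂ) ^ (-ζ) = ((1 + t ^ 2 : ℝ) : ℂ) ^ (-ζ / 2) := by
    rw [Complex.cpow_def_of_ne_zero (Complex.ofReal_ne_zero.2 h.ne'),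
      Complex.cpow_def_of_ne_zero (Complex.ofReal_ne_zero.2 (by positivity)),
      ← Complex.ofReal_log h.le, ← Complex.ofReal_log (by positivity), Real.log_sqrt h.le]
    congr 1; push_cast; ring
  rw [kernelI, weight, this]
  ring

/-- Dilation by `√(1+t²)` multiplies the Mellin transform by `√(1+t²)^{-ζ}`; integrated against
`weight`, these factors make up `I_n`. -/
theorem mellin_GStarStar (h : SupportBounds f a R C) (hf : Continuous f) {n : ℤ} {ζ ξ : ℂ}
    (hζ : nPrime n < ζ.re) (h0 : 0 < ξ.re) (h1 : ξ.re < 1) :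
    MellinConvergent (fun lam : ℝ => GStarStar f n lam ξ) ζ ∧
    mellin (fun lam : ℝ => GStarStar f n lam ξ) ζ =
      integralI n ζ ξ * mellin (reducedMellin f n ξ) ζ := by
  have hn := add_one_le_nPrime n
  have key := mellin_integral_mul_comp_mul (s := ζ) (w := weight n ξ) (c := fun t => √(1 + t ^ 2))
    (k := fun _ r => reducedMellin f n ξ r)
    (g := fun t => ‖kernelI n ζ ξ t‖ *
      ∫ x in Ioi (0 : ℝ), x ^ (ζ.re - 1) * ‖reducedMellin f n ξ x‖) ?_
    (fun t _ => by positivity)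
    (fun t _ => h.mellinConvergent_reducedMellin hf n (by linarith) ξ)
    ((integrableOn_kernelI hζ h0 h1).norm.mul_const _) ?_
  · have e : EqOn (fun lam : ℝ => GStarStar f n lam ξ)
        (fun x => ∫ t in Ioi (0 : ℝ), weight n ξ t * reducedMellin f n ξ (√(1 + t ^ 2) * x))
        (Ioi 0) := fun s hs => h.GStarStar_eq hf n hs h1
    constructor
    · refine key.1.congr_fun (fun s hs => ?_) measurableSet_Ioi
      simp only [e hs]
    · rw [integralI, ← integral_mul_const]
      simp only [kernelI_eq_weight]
      refine Eq.trans ?_ key.2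
      refine setIntegral_congr_fun measurableSet_Ioi fun s hs => ?_
      simp only [e hs]
  · rw [Measure.prod_restrict]
    refine ContinuousOn.aestronglyMeasurable (ContinuousOn.mul ?_ (ContinuousOn.mul ?_ ?_))
      (measurableSet_Ioi.prod measurableSet_Ioi)
    · exact ContinuousOn.cpow_const (by fun_prop) fun p hp => Complex.ofReal_mem_slitPlane.2 hp.2
    · refine ContinuousOn.mul ?_ ?_
      · exact ContinuousOn.cpow_const (by fun_prop) fun p hp => Complex.ofReal_mem_slitPlane.2 hp.1
      · exact ContinuousOn.zpow₀ (by fun_prop) _ fun p _ => Or.inl (one_add_I_mul_ne_zero p.1)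
    · refine (h.continuousOn_reducedMellin hf n ξ).comp (by fun_prop) fun p hp => ?_
      have : 0 < p.2 := hp.2
      exact mem_Ioi.2 (by positivity)
  · intro t _
    rw [kernelI_eq_weight, norm_mul, Complex.norm_cpow_eq_rpow_re_of_pos (by positivity),
      Complex.neg_re]

theorem U_eq (h : SupportBounds f a R C) (hf : Continuous f) {n : ℤ} {ζ ξ : ℂ}
    (hζ : nPrime n < ζ.re) (h0 : 0 < ξ.re) (h1 : ξ.re < 1) (hI : integralI n ζ ξ ≠ 0) :
    U f n ζ ξ = mellin (reducedMellin f n ξ) ζ := by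
  rw [U, (h.mellin_GStarStar hf hζ h0 h1).2, mul_div_cancel_left₀ _ hI]

/-! ### Inversion in the radius and in the height. -/

theorem hasGaussMellinInv_U (h : SupportBounds f a R C) (hf : Continuous f) {n : ℤ} {ρ : ℝ}
    (hρ : nPrime n < ρ) {ξ : ℂ} (h0 : 0 < ξ.re) (h1 : ξ.re < 1) {r : ℝ} (hr : 0 < r) :
    HasGaussMellinInv ρ (fun ζ => U f n ζ ξ) r (reducedMellin f n ξ r) := by
  have hn := add_one_le_nPrime n
  refine hasGaussMellinInv_of_ae_eq_mellin hr
    (h.mellinConvergent_reducedMellin hf n (by simpa using by linarith) ξ)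
    ((h.continuousOn_reducedMellin hf n ξ).continuousAt (Ioi_mem_nhds hr)) ?_
  filter_upwards [ae_integralI_ne_zero hρ h0 h1] with y hy
  exact h.U_eq hf (by simpa using hρ) h0 h1 hy

/-- At fixed `r`, `reducedMellin` is, as a function of `ξ`, the Mellin transform of `r^{-n} f_n(r,
·)`. Almost everywhere equality suffices for `H`, as an inner limit may be known only for almost
every `ξ`. -/
theorem hasGaussMellinInv_reducedMellin (h : SupportBounds f a R C) (hf : Continuous f) (n : ℤ)
    (r ρ : ℝ) {τ : ℝ} (hτ : 0 < τ) {H : ℂ → ℂ}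
    (hH : ∀ᵐ y : ℝ, H ((ρ : ℂ) + y * Complex.I) =
      reducedMellin f n ((ρ : ℂ) + y * Complex.I) r) :
    HasGaussMellinInv ρ H τ ((r : ℂ) ^ (-n) * fCoeff f n r τ) := by
  have hc : Continuous fun τ => fCoeff f n r τ :=
    (continuous_fCoeff hf n).comp (by fun_prop : Continuous fun x : ℝ => (r, x))
  refine hasGaussMellinInv_of_ae_eq_mellin (φ := fun τ => (r : ℂ) ^ (-n) * fCoeff f n r τ) hτ
    ((h.mellinConvergent_fCoeff hf n ρ r).const_smul ((r : ℂ) ^ (-n)))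
    (continuous_const.mul hc).continuousAt ?_
  filter_upwards [hH] with y hy
  rw [hy]
  exact (mellin_const_smul (fun τ => fCoeff f n r τ) _ ((r : ℂ) ^ (-n))).symm

end SupportBounds

end EquidistantLines

theorem theorem2p5 (f : EquidistantLines.E3 → ℂ) (hf : Continuous f)
    (hfc : HasCompactSupport f) (hfs : tsupport f ⊆ {x | 0 < x 2}) (n : ℤ) :
    -- The transforms that enter the formula converge on the stated domains,
    (∀ lam : ℝ, 0 ≤ lam → ∀ ξ : ℂ, 0 < ξ.re → ξ.re < 1 →
      MellinConvergent (fun s : ℝ => EquidistantLines.GStar f n lam s) ξ) ∧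
    (∀ ζ ξ : ℂ, EquidistantLines.nPrime n < ζ.re → 0 < ξ.re → ξ.re < 1 →
      MellinConvergent (fun lam : ℝ => EquidistantLines.GStarStar f n lam ξ) ζ ∧
      IntegrableOn (EquidistantLines.kernelI n ζ ξ) (Ioi 0)) ∧
    -- and the denominator vanishes at most on a null set of every line of integration.
    (∀ ρ₁ : ℝ, EquidistantLines.nPrime n < ρ₁ → ∀ ξ : ℂ, 0 < ξ.re → ξ.re < 1 →
      ∀ᵐ y : ℝ, EquidistantLines.integralI n ((ρ₁ : ℂ) + y * Complex.I) ξ ≠ 0) ∧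
    -- The inversion formula for `r, τ > 0`, the inversion integrals being taken in the Gauss sense:
    (∀ r : ℝ, 0 < r → ∃ H : ℂ → ℂ,
      (∀ ρ₁ : ℝ, EquidistantLines.nPrime n < ρ₁ → ∀ ξ : ℂ, 0 < ξ.re → ξ.re < 1 →
        EquidistantLines.HasGaussMellinInv ρ₁ (fun ζ => EquidistantLines.U f n ζ ξ) r (H ξ)) ∧
      ∀ ρ₂ : ℝ, 0 < ρ₂ → ρ₂ < 1 → ∀ τ : ℝ, 0 < τ → ∃ v : ℂ,
        EquidistantLines.HasGaussMellinInv ρ₂ H τ v ∧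
        EquidistantLines.fCoeff f n r τ = (r : ℂ) ^ n * v) ∧
    -- The same formula with the inversion integrals themselves, whenever they converge:
    (∀ r τ ρ₁ ρ₂ : ℝ, 0 < r → 0 < τ → EquidistantLines.nPrime n < ρ₁ → 0 < ρ₂ → ρ₂ < 1 →
      ∀ (H : ℂ → ℂ) (v : ℂ),
        (∀ᵐ y : ℝ, EquidistantLines.HasMellinInv ρ₁
          (fun ζ => EquidistantLines.U f n ζ ((ρ₂ : ℂ) + y * Complex.I)) r
          (H ((ρ₂ : ℂ) + y * Complex.I))) →
        EquidistantLines.HasMellinInv ρ₂ H τ v →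
        EquidistantLines.fCoeff f n r τ = (r : ℂ) ^ n * v) ∧
    -- Values at `r = 0` or `τ = 0` are the limits of those at `r, τ > 0`.
    (∀ r₀ τ₀ : ℝ, 0 ≤ r₀ → 0 ≤ τ₀ →
      Tendsto (fun p : ℝ × ℝ => EquidistantLines.fCoeff f n p.1 p.2)
        (𝓝[Ioi 0 ×ˢ Ioi 0] (r₀, τ₀)) (𝓝 (EquidistantLines.fCoeff f n r₀ τ₀))) := by
  obtain ⟨a, R, C, h⟩ := EquidistantLines.exists_supportBounds hf hfc hfs
  have hcancel : ∀ r : ℝ, 0 < r → ∀ z : ℂ, (r : ℂ) ^ n * ((r : ℂ) ^ (-n) * z) = z := fun r hr z => by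
    rw [zpow_neg, mul_inv_cancel_left₀ (zpow_ne_zero n (Complex.ofReal_ne_zero.2 hr.ne'))]
  refine ⟨fun lam _ ξ _ h1 => (h.mellin_GStar hf n lam h1).1,
    fun ζ ξ hζ h0 h1 => ⟨(h.mellin_GStarStar hf hζ h0 h1).1,
      EquidistantLines.integrableOn_kernelI hζ h0 h1⟩,
    fun ρ₁ hρ ξ h0 h1 => EquidistantLines.ae_integralI_ne_zero hρ h0 h1, fun r hr => ?_, ?_, ?_⟩
  -- The witness does not involve `ρ₁`, so the inner inversion is independent of the line.
  · refine ⟨fun ξ => EquidistantLines.reducedMellin f n ξ r,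
      fun ρ₁ hρ ξ h0 h1 => h.hasGaussMellinInv_U hf hρ h0 h1 hr, fun ρ₂ _ _ τ hτ =>
      ⟨(r : ℂ) ^ (-n) * EquidistantLines.fCoeff f n r τ,
        h.hasGaussMellinInv_reducedMellin hf n r ρ₂ hτ (Eventually.of_forall fun _ => rfl), ?_⟩⟩
    rw [hcancel r hr]
  · intro r τ ρ₁ ρ₂ hr hτ hρ₁ h0 h1 H v hH hv
    -- Where the inner integral converges, its value is that of its Gauss means, which identifies
    -- `H` almost everywhere on the line.
    have hH' : ∀ᵐ y : ℝ, H ((ρ₂ : ℂ) + y * Complex.I) =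
        EquidistantLines.reducedMellin f n ((ρ₂ : ℂ) + y * Complex.I) r := by
      filter_upwards [hH] with y hy
      exact hy.eq_of_hasGaussMellinInv
        (h.hasGaussMellinInv_U hf hρ₁ (by simpa using h0) (by simpa using h1) hr)
    rw [hv.eq_of_hasGaussMellinInv (h.hasGaussMellinInv_reducedMellin hf n r ρ₂ hτ hH'),
      hcancel r hr]
  · intro r₀ τ₀ _ _
    exact ((EquidistantLines.continuous_fCoeff hf n).tendsto (r₀, τ₀)).mono_left nhdsWithin_le_nhds
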